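/- Let $n\in\{2,3\}$. Let $\hat{\mathcal Q}$ be a parametric hierarchical mesh of $\hat\Omega_0=(0,1)^n$, that is, the set of active cells of a hierarchy $(0,1)^n=\hat\Omega_0^0\supseteq\hat\Omega_0^1\supseteq\dots\supseteq\hat\Omega_0^L=\emptyset$ in which each $\hat\Omega_0^{\ell+1}$ is the interior of a union of closed cells of level $\ell$, the cells of level $\ell$ being the open boxes of a Cartesian grid given by finite sets of breakpoints in $[0,1]$ (containing $0$ and $1$) that are nested with respect to $\ell$; a cell $\hat K$ of level $\ell$ is active if $\hat K\subseteq\hat\Omega_0^\ell$ and $\hat K\not\subseteq\hat\Omega_0^{\ell+1}$. Let $\mathbf F:(0,1)^n\to\Omega_0\subset\mathbb R^n$ be a surjective bi-Lipschitz map such that $\mathbf F$ and $\mathbf F^{-1}$ are, respectively, $C^\infty$ on the closure of every $\hat K\in\hat{\mathcal Q}$ and on the closure of every element $K$ of the physical mesh $\mathcal Q=\{\mathbf F(\hat K):\hat K\in\hat{\mathcal Q}\}$. Let $h_K$ be the diameter of $K$ for the distance given by the infimum of the lengths of piecewise $C^1$ paths in $K$, let $\rho_K$ be the radius of the largest ball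 inscribed in $K$, and assume that $\mathcal Q$ is shape regular: $h_K\le\sigma\rho_K$ for all $K\in\mathcal Q$. Let $D_1,\dots,D_s$ be bounded open domains in $\mathbb R^n$, $D=\operatorname{int}\big(\bigcup_i\overline{D_i}\big)$ and $\Omega=\Omega_0\setminus\overline D$. Let $$\mathcal Q_{\rm cut}=\{K\in\mathcal Q: K\cap\Omega\ne K,\ |K\cap\Omega|>0\}.$$ Let $\eta>0$ be the unique solution of $\eta=-\log\eta$, and for $S\subset\mathbb R^n$ with $0<|S|<\infty$ put $c_S=\max(-\log|S|,\eta)^{1/2}$ if $n=2$ and $c_S=1$ if $n=3$. For an element $K$ with $|K\cap\Omega|>0$ let $\delta_K=h_K$ if $K\subseteq\Omega$, and $\delta_K=c_{K\cap\Omega}\,|K\cap\Omega|^{1/n}$ if $K\in\mathcal Q_{\rm cut}$. Then for all $K\in\mathcal Q_{\rm cut}$, with $K_\Omega:=K\cap\Omega$, and all $v\in H^1(K)$, $$\|v\|_{0,K_\Omega}\le C\,c_{K_\Omega}|K_\Omega|^{1/n}\left(h_K^{-2}\|v\|_{0,K}^2+\|\nabla v\|_{0,K}^2\right)^{1/2}=C\,\delta_K\left(h_K^{-2}\|v\|_{0,K}^2+\|\nabla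 v\|_{0,K}^2\right)^{1/2},$$ where $\|\cdot\|_{0,S}$ is the norm of $L^2(S)$ and the constant $C$ depends only on $n$, on $\sigma$ and on a bound $\Lambda$ for the Lipschitz constants of $\mathbf F$ and $\mathbf F^{-1}$. In particular, $C$ is independent of the measures of $K_\Omega$ and of $K$, of the mesh (its size and its number of levels), of the trimming, and of $v$. -/

import Mathlib

open Set MeasureTheory Filter Topology
open scoped ContDiff ENNReal

noncomputable section

namespace TrimmedIGA

/-- The space `ℝⁿ` with its Euclidean norm. -/
abbrev E (n : ℕ) : Type := EuclideanSpace ℝ (Fin n)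

/-! ### Intrinsic diameter and inscribed radius -/

/-- A continuous, piecewise `C¹` path `[0,1] → U` from `ξ` to `ζ`: on each closed interval of
some finite partition `0 = t₀ ≤ t₁ ≤ ⋯ ≤ t_m = 1`, it is `C¹` up to the end points. -/
structure IsPiecewiseC1Path {n : ℕ} (U : Set (E n)) (ξ ζ : E n) (γ : ℝ → E n) : Prop where
  continuousOn : ContinuousOn γ (Icc 0 1)
  mapsTo : MapsTo γ (Icc 0 1) U
  source : γ 0 = ξ
  target : γ 1 = ζ
  piecewise : ∃ (m : ℕ) (t : Fin (m + 1) → ℝ), Monotone t ∧ t 0 = 0 ∧ t (Fin.last m) = 1 ∧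
    ∀ i : Fin m, ContDiffOn ℝ 1 γ (Icc (t i.castSucc) (t i.succ))

/-- Infimum of the lengths of the piecewise `C¹` paths in `U` between `ξ` and `ζ` (the length of
a path is its total variation). -/
def pathDist {n : ℕ} (U : Set (E n)) (ξ ζ : E n) : ℝ≥0∞ :=
  ⨅ (γ : ℝ → E n) (_ : IsPiecewiseC1Path U ξ ζ γ), eVariationOn γ (Icc 0 1)

/-- The diameter of `U` for the path distance `pathDist U`. -/
def pathDiam {n : ℕ} (U : Set (E n)) : ℝ :=
  (⨆ (ξ ∈ U) (ζ ∈ U), pathDist U ξ ζ).toReal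

/-- The radius of the largest ball inscribed in `U`. -/
def inradius {n : ℕ} (U : Set (E n)) : ℝ :=
  sSup {r : ℝ | 0 < r ∧ ∃ x, Metric.ball x r ⊆ U}

/-! ### Hierarchical meshes -/

/-- The parametric domain `(0,1)ⁿ`. -/
def unitCube (n : ℕ) : Set (E n) := {x | ∀ j, 0 < x j ∧ x j < 1}

/-- `a < b` are two consecutive breakpoints of `Z`. -/
def IsKnotSpan (Z : Finset ℝ) (a b : ℝ) : Prop :=
  a ∈ Z ∧ b ∈ Z ∧ a < b ∧ ∀ z ∈ Z, ¬ (a < z ∧ z < b)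

/-- The parametric Bézier mesh of the breakpoints `Z j` in the directions `j`: all open boxes
whose sides are spans between consecutive breakpoints. -/
def bezierMesh {n : ℕ} (Z : Fin n → Finset ℝ) : Set (Set (E n)) :=
  {Q | ∃ a b : Fin n → ℝ, (∀ j, IsKnotSpan (Z j) (a j) (b j)) ∧
    Q = {x | ∀ j, a j < x j ∧ x j < b j}}

/-- The data of a parametric hierarchical mesh: nested breakpoints for the levels `0, …, L`, and
a hierarchy of sub-domains `(0,1)ⁿ = Ω̂⁰ ⊇ Ω̂¹ ⊇ ⋯ ⊇ Ω̂ᴸ = ∅` in which `Ω̂^(ℓ+1)` is a union of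
cells of level `ℓ`. -/
structure HierarchicalMesh (n : ℕ) where
  /-- the depth of the hierarchy -/
  L : ℕ
  /-- the breakpoints of each level in each direction -/
  breakpoints : ℕ → Fin n → Finset ℝ
  /-- the sub-domain of each level -/
  subdomain : ℕ → Set (E n)
  zero_mem : ∀ ℓ ≤ L, ∀ j, (0 : ℝ) ∈ breakpoints ℓ j
  one_mem : ∀ ℓ ≤ L, ∀ j, (1 : ℝ) ∈ breakpoints ℓ j
  mem_Icc : ∀ ℓ ≤ L, ∀ j, ∀ z ∈ breakpoints ℓ j, z ∈ Icc (0 : ℝ) 1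
  nested : ∀ ℓ < L, ∀ j, breakpoints ℓ j ⊆ breakpoints (ℓ + 1) j
  subdomain_zero : subdomain 0 = unitCube n
  subdomain_L : subdomain L = ∅
  subdomain_anti : ∀ ℓ < L, subdomain (ℓ + 1) ⊆ subdomain ℓ
  subdomain_cells : ∀ ℓ < L, ∃ S ⊆ bezierMesh (breakpoints ℓ),
    subdomain (ℓ + 1) = interior (⋃ Q ∈ S, closure Q)

/-- The active cells of all levels, that is, the parametric hierarchical mesh. (There are none at
level `L` because the cells are not empty, so the value of `subdomain (L + 1)` is immaterial.) -/
def HierarchicalMesh.cells {n : ℕ} (M : HierarchicalMesh n) : Set (Set (E n)) :=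
  {Q | ∃ ℓ ≤ M.L, Q ∈ bezierMesh (M.breakpoints ℓ) ∧ Q ⊆ M.subdomain ℓ ∧
    ¬ Q ⊆ M.subdomain (ℓ + 1)}

/-- The physical hierarchical mesh: the images of the active cells under `F`. -/
def physicalMesh {n : ℕ} (M : HierarchicalMesh n) (F : E n → E n) : Set (Set (E n)) :=
  {K | ∃ Q ∈ M.cells, K = F '' Q}

/-- The regularity of the parametrization: `F` is bi-Lipschitz on `(0,1)ⁿ` with constants at most
`Λ`; on every closed cell, `F` is `C^∞`, and so is the inverse of `F` on every closed physical
element. (Only the values of `F` in `(0,1)ⁿ` matter.) -/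
structure IsRegularParametrization {n : ℕ} (Λ : ℝ) (M : HierarchicalMesh n) (F : E n → E n) :
    Prop where
  lipschitz : ∀ x ∈ unitCube n, ∀ y ∈ unitCube n, dist (F x) (F y) ≤ Λ * dist x y
  lipschitz_inv : ∀ x ∈ unitCube n, ∀ y ∈ unitCube n, dist x y ≤ Λ * dist (F x) (F y)
  smooth : ∀ Q ∈ M.cells, ∃ G : E n → E n, ContDiffOn ℝ ∞ G (closure Q) ∧ EqOn G F Q
  smooth_inv : ∀ Q ∈ M.cells, ∃ H : E n → E n, ContDiffOn ℝ ∞ H (closure (F '' Q)) ∧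
    ∀ x ∈ Q, H (F x) = x

/-- Shape regularity with constant `σ`: `h_K ≤ σ ρ_K` for all elements `K`, where `h_K` is the
diameter of `K` and `ρ_K` is its inscribed radius. -/
def ShapeRegular {n : ℕ} (σ : ℝ) (𝒬 : Set (Set (E n))) : Prop :=
  ∀ K ∈ 𝒬, pathDiam K ≤ σ * inradius K

/-! ### Trimming -/

/-- The trimmed domain `Ω = Ω₀ \ closure D` with `Ω₀ = F((0,1)ⁿ)` and
`D = int (⋃ closure Dᵢ)`. -/
def trimmedDomain {n s : ℕ} (F : E n → E n) (D : Fin s → Set (E n)) : Set (E n) :=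
  (F '' unitCube n) \ closure (interior (⋃ i, closure (D i)))

/-- The cut elements of the mesh `𝒬` with respect to `Ω`. -/
def cutElements {n : ℕ} (𝒬 : Set (Set (E n))) (Ω : Set (E n)) : Set (Set (E n)) :=
  {K | K ∈ 𝒬 ∧ K ∩ Ω ≠ K ∧ 0 < volume (K ∩ Ω)}

theorem existsUnique_eta : ∃! η : ℝ, 0 < η ∧ η = -Real.log η := by
  have hc : ContinuousOn (fun x : ℝ => x + Real.log x) (Icc (Real.exp (-1)) 1) := by
    refine continuousOn_id.add (Real.continuousOn_log.mono ?_)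
    intro x hx
    exact (lt_of_lt_of_le (Real.exp_pos _) hx.1).ne'
  have h1 : Real.exp (-1) ≤ 1 := by
    rw [Real.exp_le_one_iff]; norm_num
  have h0 : (0 : ℝ) ∈ Icc (Real.exp (-1) + Real.log (Real.exp (-1))) (1 + Real.log 1) := by
    rw [Real.log_exp, Real.log_one]
    constructor <;> linarith
  obtain ⟨x, hx, hx0⟩ := intermediate_value_Icc h1 hc h0
  have hxp : 0 < x := lt_of_lt_of_le (Real.exp_pos _) hx.1
  refine ⟨x, ⟨hxp, by simp only at hx0; linarith⟩, ?_⟩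
  rintro y ⟨hy, hy0⟩
  simp only at hx0
  rcases lt_trichotomy y x with h | h | h
  · have := Real.log_lt_log hy h
    linarith
  · exact h
  · have := Real.log_lt_log hxp h
    linarith

/-- The unique positive solution of `η = -log η`. -/
def eta : ℝ := existsUnique_eta.choose

theorem eta_spec : 0 < eta ∧ eta = -Real.log eta := existsUnique_eta.choose_spec.1

/-- The constant `c_S`: `max(-log |S|, η)^(1/2)` if `n = 2`, and `1` otherwise
(it is used for `n = 2` and `n = 3` only). -/
def cConst {n : ℕ} (S : Set (E n)) : ℝ :=
  if n = 2 then Real.sqrt (max (-Real.log (volume.real S)) eta) else 1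

open Classical in
/-- The scale `δ_K` of an active element: `h_K` if `K ⊆ Ω`, and `c_{K∩Ω} |K∩Ω|^(1/n)` if `K` is
cut. -/
def delta {n : ℕ} (Ω K : Set (E n)) : ℝ :=
  if K ⊆ Ω then pathDiam K
  else cConst (K ∩ Ω) * volume.real (K ∩ Ω) ^ (1 / (n : ℝ))

/-! ### The Sobolev space `H¹` -/

/-- The `L²(S)` norm of a scalar or vector field. -/
def l2Norm {n : ℕ} {V : Type*} [NormedAddCommGroup V] (f : E n → V) (S : Set (E n)) : ℝ :=
  Real.sqrt (∫ x in S, ‖f x‖ ^ 2)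

/-- `v ∈ H¹(U)` with weak gradient `g`: both are square integrable on `U`, and
`∫_U v ∂ᵢφ = - ∫_U gᵢ φ` for all `i` and all `φ ∈ C_c^∞(U)`. -/
structure IsH1WithGradient {n : ℕ} (U : Set (E n)) (v : E n → ℝ) (g : E n → E n) : Prop where
  memLp : MemLp v 2 (volume.restrict U)
  memLp_grad : MemLp g 2 (volume.restrict U)
  integral_eq : ∀ φ : E n → ℝ, ContDiff ℝ ∞ φ → HasCompactSupport φ → tsupport φ ⊆ U →
    ∀ i : Fin n, ∫ x in U, v x * fderiv ℝ φ x (EuclideanSpace.single i 1) =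
      - ∫ x in U, g x i * φ x

end TrimmedIGA

end

noncomputable section

namespace TrimmedIGA

/-! ### Elementary facts on lower Lebesgue integrals -/

/-! No Sobolev embedding is used: the estimate comes from averaging the fundamental theorem of
calculus over segments. Pull `v` back to the convex cell `Q`, with `u = v ∘ F`. For `x` in the
pulled-back active part `A` and `y ∈ Q`, `|u(x)| ≤ |u(y)| + ∫₀¹ |∇u|(x + t(y-x)) |x-y| dt`. Cut the
integral at a small parameter `s`, square, and integrate over `x ∈ A` and `y ∈ Q`.

The part `t ≤ s` contributes `|Q| s² d² ‖∇u‖²` up to a constant (`lintegral_near_le`). On `t > s`,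
Cauchy–Schwarz with weight `t^(n-1)` and the substitution `z = x + t(y-x)` in `y` give a bound
uniform in `x` (`lintegral_far_le`). The contribution is therefore `|A| d² ‖∇u‖²` times `∫_s^1
t^(1-n) dt`, which is `-log s` for `n = 2` and at most `1/s` for `n = 3`. With `s` comparable to
`|S|^(1/n) / h`, where `S` is the active part of the element, and `|Q|` bounded below by `h^n`
through shape regularity, both parts have size `|Q| |S|^(2/n)`, up to the logarithm that `c_S²`
absorbs when `n = 2` (`exists_farWeight_bound`).

Passing from `C¹` functions to `H¹` is done by mollifying on slightly shrunken cells, whose images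
stay away from the boundary of the element, and applying Fatou's lemma. Neither smoothness of the
element boundary nor an extension operator is needed. -/

theorem sq_lintegral_mul_le {α : Type*} [MeasurableSpace α] (μ : Measure α) {f g : α → ℝ≥0∞}
    (hf : AEMeasurable f μ) (hg : AEMeasurable g μ) :
    (∫⁻ a, f a * g a ∂μ) ^ 2 ≤ (∫⁻ a, f a ^ 2 ∂μ) * ∫⁻ a, g a ^ 2 ∂μ := by
  have h := ENNReal.lintegral_mul_le_Lp_mul_Lq μ Real.HolderConjugate.two_two hf hg
  have h2 := pow_le_pow_left' h 2
  have key : ∀ a : ℝ≥0∞, (a ^ (1 / (2 : ℝ))) ^ 2 = a := by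
    intro a
    rw [← ENNReal.rpow_natCast, ← ENNReal.rpow_mul]
    norm_num
  rw [mul_pow, key, key] at h2
  simpa using h2

theorem add_add_sq_le (a b c : ℝ≥0∞) : (a + b + c) ^ 2 ≤ 3 * (a ^ 2 + b ^ 2 + c ^ 2) := by
  rcases eq_or_ne a ⊤ with rfl | ha
  · simp [ENNReal.mul_top]
  rcases eq_or_ne b ⊤ with rfl | hb
  · simp [ENNReal.mul_top]
  rcases eq_or_ne c ⊤ with rfl | hc
  · simp [ENNReal.mul_top]
  lift a to NNReal using ha
  lift b to NNReal using hb
  lift c to NNReal using hc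
  norm_cast
  rw [← NNReal.coe_le_coe]
  push_cast
  nlinarith [sq_nonneg ((a : ℝ) - b), sq_nonneg ((a : ℝ) - c), sq_nonneg ((b : ℝ) - c)]

theorem lintegral_comp_add_smul {n : ℕ} {g : E n → ℝ≥0∞} (hg : Measurable g) (c : E n) {r : ℝ}
    (hr : 0 < r) :
    ∫⁻ x, g (c + r • x) = ENNReal.ofReal ((r ^ n)⁻¹) * ∫⁻ x, g x := by
  have h := Measure.map_addHaar_smul (volume : Measure (E n)) hr.ne'
  have h1 : ∫⁻ x, g (c + r • x) = ∫⁻ y, g (c + y) ∂(Measure.map (fun x => r • x) volume) := by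
    rw [lintegral_map (by fun_prop) (by fun_prop)]
  rw [h1, h, lintegral_smul_measure, lintegral_add_left_eq_self g c, smul_eq_mul,
    finrank_euclideanSpace_fin, abs_of_pos (by positivity)]

/-- The condition in the integrand cuts the integral off below `ρ / d`, and `∫_{ρ/d}^∞ t⁻³ dt = d² /
(2ρ²)`. The cancellation of `ρ²` is what makes the far estimate free of any singular kernel. -/
theorem ofReal_sq_mul_lintegral_le {ρ d s : ℝ} (hρ : 0 ≤ ρ) (hd : 0 < d) :
    ENNReal.ofReal (ρ ^ 2) * ∫⁻ t in Ioc s 1,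
      (if ρ ≤ t * d then ENNReal.ofReal (t ^ (-3 : ℝ)) else 0) ≤ ENNReal.ofReal (d ^ 2 / 2) := by
  rcases hρ.eq_or_lt with rfl | hρ
  · simp
  have hc : 0 < ρ / d := by positivity
  have h1 : ∫⁻ t in Ioc s 1, (if ρ ≤ t * d then ENNReal.ofReal (t ^ (-3 : ℝ)) else 0) ≤
      ∫⁻ t in Ioi (ρ / d), ENNReal.ofReal (t ^ (-3 : ℝ)) := by
    calc _ ≤ ∫⁻ t, (if ρ ≤ t * d then ENNReal.ofReal (t ^ (-3 : ℝ)) else 0) :=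
          setLIntegral_le_lintegral _ _
      _ = ∫⁻ t, (Ici (ρ / d)).indicator (fun t => ENNReal.ofReal (t ^ (-3 : ℝ))) t := by
          congr 1
          ext t
          simp only [indicator_apply, mem_Ici, div_le_iff₀ hd]
      _ = ∫⁻ t in Ici (ρ / d), ENNReal.ofReal (t ^ (-3 : ℝ)) :=
          lintegral_indicator measurableSet_Ici _
      _ = _ := by rw [restrict_Ioi_eq_restrict_Ici]
  have h2 : ∫⁻ t in Ioi (ρ / d), ENNReal.ofReal (t ^ (-3 : ℝ)) =
      ENNReal.ofReal ((ρ / d) ^ (-2 : ℝ) / 2) := by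
    rw [← ofReal_integral_eq_lintegral_ofReal
      (integrableOn_Ioi_rpow_of_lt (by norm_num) hc), integral_Ioi_rpow_of_lt (by norm_num) hc]
    · norm_num [neg_div_neg_eq]
    · filter_upwards [self_mem_ae_restrict measurableSet_Ioi] with t ht
      exact Real.rpow_nonneg (hc.le.trans (le_of_lt ht)) _
  calc _ ≤ ENNReal.ofReal (ρ ^ 2) * ENNReal.ofReal ((ρ / d) ^ (-2 : ℝ) / 2) := by
        gcongr
        exact h1.trans h2.le
    _ = _ := by
        rw [← ENNReal.ofReal_mul (by positivity)]
        congr 1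
        rw [Real.rpow_neg hc.le, Real.rpow_two]
        field_simp

/-! ### The averaged potential estimate on convex sets -/

/-- For `t ≤ s ≤ 1/2` the substitution is made in `x`, not in `y`: its Jacobian `(1-t)^(-n)` is at
most `2^n`. The smallness of `A` is given up; the gain is the length `s` of the parameter interval.
-/
theorem lintegral_near_le {n : ℕ} {Q : Set (E n)}
    {φ : E n → ℝ≥0∞} (hφ : Measurable φ) (A : Set (E n)) {s : ℝ} (hs : 0 < s) (hs2 : s ≤ 1 / 2) :
    ∫⁻ x in A, ∫⁻ y in Q, ∫⁻ t in Ioc 0 s, φ (x + t • (y - x)) ≤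
      ENNReal.ofReal s * (volume Q * (2 ^ n * ∫⁻ z, φ z)) := by
  have hin : ∀ t ∈ Ioc 0 s, ∀ y : E n, ∫⁻ x, φ (x + t • (y - x)) ≤ 2 ^ n * ∫⁻ z, φ z := by
    intro t ht y
    have h1t : 1 / 2 ≤ 1 - t := by linarith [ht.2]
    have : ∀ x, x + t • (y - x) = t • y + (1 - t) • x := by intro x; module
    simp_rw [this]
    rw [lintegral_comp_add_smul hφ _ (by linarith)]
    gcongr
    rw [← inv_pow]
    calc ENNReal.ofReal ((1 - t)⁻¹ ^ n) ≤ ENNReal.ofReal (2 ^ n) := by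
          apply ENNReal.ofReal_le_ofReal
          gcongr
          rw [inv_le_comm₀ (by linarith) (by norm_num)]
          linarith
      _ = 2 ^ n := by rw [ENNReal.ofReal_pow (by norm_num)]; norm_num
  calc _ ≤ ∫⁻ x, ∫⁻ y in Q, ∫⁻ t in Ioc 0 s, φ (x + t • (y - x)) :=
        setLIntegral_le_lintegral _ _
    _ = ∫⁻ y in Q, ∫⁻ x, ∫⁻ t in Ioc 0 s, φ (x + t • (y - x)) := by
        rw [lintegral_lintegral_swap]
        apply Measurable.aemeasurable
        exact Measurable.lintegral_prod_right'
          (f := fun p : (E n × E n) × ℝ => φ (p.1.1 + p.2 • (p.1.2 - p.1.1))) (by fun_prop)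
    _ = ∫⁻ y in Q, ∫⁻ t in Ioc 0 s, ∫⁻ x, φ (x + t • (y - x)) := by
        congr 1
        ext y
        rw [lintegral_lintegral_swap]
        apply Measurable.aemeasurable
        fun_prop
    _ ≤ ∫⁻ y in Q, ∫⁻ t in Ioc 0 s, 2 ^ n * ∫⁻ z, φ z :=
        lintegral_mono fun y => setLIntegral_mono' measurableSet_Ioc fun t ht => hin t ht y
    _ = _ := by
        simp only [lintegral_const, Measure.restrict_apply MeasurableSet.univ, univ_inter,
          Real.volume_Ioc, sub_zero]
        ring

/-- Here the substitution `z = x + t(y-x)` is made in `y`, with `x` fixed. The bound does not depend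
on `x`, so a later integration over `x ∈ A` produces the factor `|A|`. -/
theorem lintegral_far_le {n : ℕ} {Q : Set (E n)}
    {d : ℝ} (hd : 0 < d) (hdiam : ∀ x ∈ Q, ∀ y ∈ Q, dist x y ≤ d) (hQm : MeasurableSet Q)
    {φ : E n → ℝ≥0∞} (hφ : Measurable φ) {s : ℝ} (hs : 0 < s) (hn : 1 ≤ n) {x : E n}
    (hx : x ∈ Q) :
    ∫⁻ y in Q, ∫⁻ t in Ioc s 1,
        ENNReal.ofReal (t ^ (n - 1)) * φ (x + t • (y - x)) * ENNReal.ofReal (dist x y) ^ 2 ≤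
      ENNReal.ofReal (d ^ 2 / 2) * ∫⁻ z, φ z := by
  have hin : ∀ t ∈ Ioc s 1, ∫⁻ y in Q,
      ENNReal.ofReal (t ^ (n - 1)) * φ (x + t • (y - x)) * ENNReal.ofReal (dist x y) ^ 2 ≤
      ∫⁻ z, φ z * ENNReal.ofReal (dist x z ^ 2) *
        (if dist x z ≤ t * d then ENNReal.ofReal (t ^ (-3 : ℝ)) else 0) := by
    intro t ht
    have ht0 : 0 < t := hs.trans ht.1
    -- The integrand in the variable `z`, where `|x-y| = |x-z| / t`. The cutoff records that `y ∈ Q`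
    -- forces `|x-z| ≤ t d`.
    set ψ : E n → ℝ≥0∞ := fun z => ENNReal.ofReal (t ^ (n - 1)) * φ z *
      (ENNReal.ofReal (dist x z ^ 2 / t ^ 2) * if dist x z ≤ t * d then 1 else 0) with hψ
    have hψm : Measurable ψ := by
      refine Measurable.mul (by fun_prop) (Measurable.mul (by fun_prop) ?_)
      exact Measurable.ite (measurableSet_le (by fun_prop) (by fun_prop)) measurable_const
        measurable_const
    calc _ ≤ ∫⁻ y in Q, ψ ((1 - t) • x + t • y) := by
          refine setLIntegral_mono' hQm fun y hy => ?_
          have e : x + t • (y - x) = (1 - t) • x + t • y := by module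
          have hdz : dist x ((1 - t) • x + t • y) = t * dist x y := by
            rw [← e, dist_eq_norm, dist_eq_norm, ← norm_neg, neg_sub, add_sub_cancel_left,
              norm_smul, Real.norm_eq_abs, abs_of_pos ht0, norm_sub_rev]
          simp only [hψ, e, hdz]
          rw [if_pos (by gcongr; exact hdiam x hx y hy), mul_one]
          gcongr
          rw [← ENNReal.ofReal_pow dist_nonneg, mul_pow, mul_div_cancel_left₀ _ (by positivity)]
      _ ≤ ∫⁻ y, ψ ((1 - t) • x + t • y) := setLIntegral_le_lintegral _ _
      _ = ENNReal.ofReal ((t ^ n)⁻¹) * ∫⁻ z, ψ z := lintegral_comp_add_smul hψm _ ht0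
      _ = ∫⁻ z, ENNReal.ofReal ((t ^ n)⁻¹) * ψ z := (lintegral_const_mul _ hψm).symm
      _ = _ := by
          congr 1
          ext z
          simp only [hψ]
          split_ifs
          -- Jacobian `t^(-n)`, weight `t^(n-1)` and `t^(-2)` from the squared distance: the
          -- exponent is `-3` in every dimension.
          · have h3 : t ^ (-3 : ℝ) = (t ^ n)⁻¹ * t ^ (n - 1) * (t ^ 2)⁻¹ := by
              obtain ⟨k, rfl⟩ : ∃ k, n = k + 1 := ⟨n - 1, by omega⟩
              rw [Real.rpow_neg ht0.le]
              have : t ^ (3 : ℝ) = t ^ 3 := by exact_mod_cast Real.rpow_natCast t 3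
              rw [this, Nat.add_sub_cancel]
              field_simp
              ring
            rw [h3, ENNReal.ofReal_mul (by positivity), ENNReal.ofReal_mul (by positivity),
              div_eq_mul_inv, ENNReal.ofReal_mul (by positivity)]
            ring
          · simp
  have hm2 : Measurable fun p : ℝ × E n => φ p.2 * ENNReal.ofReal (dist x p.2 ^ 2) *
        (if dist x p.2 ≤ p.1 * d then ENNReal.ofReal (p.1 ^ (-3 : ℝ)) else 0) := by
    refine Measurable.mul (by fun_prop) ?_
    exact Measurable.ite (measurableSet_le (by fun_prop) (by fun_prop)) (by fun_prop)
      measurable_const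
  calc _ = ∫⁻ t in Ioc s 1, ∫⁻ y in Q,
      ENNReal.ofReal (t ^ (n - 1)) * φ (x + t • (y - x)) * ENNReal.ofReal (dist x y) ^ 2 := by
        rw [lintegral_lintegral_swap]
        apply Measurable.aemeasurable
        fun_prop
    _ ≤ ∫⁻ t in Ioc s 1, ∫⁻ z, φ z * ENNReal.ofReal (dist x z ^ 2) *
        (if dist x z ≤ t * d then ENNReal.ofReal (t ^ (-3 : ℝ)) else 0) :=
        setLIntegral_mono' measurableSet_Ioc hin
    _ = ∫⁻ z, ∫⁻ t in Ioc s 1, φ z * ENNReal.ofReal (dist x z ^ 2) *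
        (if dist x z ≤ t * d then ENNReal.ofReal (t ^ (-3 : ℝ)) else 0) := by
        rw [lintegral_lintegral_swap hm2.aemeasurable]
    _ ≤ ∫⁻ z, φ z * ENNReal.ofReal (d ^ 2 / 2) := by
        refine lintegral_mono fun z => ?_
        rw [lintegral_const_mul _ (Measurable.ite (measurableSet_le (by fun_prop) (by fun_prop))
          (by fun_prop) measurable_const), mul_assoc]
        gcongr
        exact ofReal_sq_mul_lintegral_le dist_nonneg hd
    _ = _ := by rw [lintegral_mul_const _ hφ, mul_comm]

/-- The weight `∫_s^1 t^(1-n) dt` of the part of the potential away from its pole. -/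
def farWeight (n : ℕ) (s : ℝ) : ℝ≥0∞ := ∫⁻ t in Ioc s 1, ENNReal.ofReal ((t ^ (n - 1))⁻¹)

set_option maxHeartbeats 1000000 in
-- Averaging over the free end point `y ∈ Q` produces the factor `|Q|` on the left; the constant 3
-- comes from squaring the sum of the end value, the near part and the far part.
theorem volume_mul_lintegral_sq_le {n : ℕ} (hn : 1 ≤ n) {Q : Set (E n)} (hQm : MeasurableSet Q)
    (hQc : Convex ℝ Q) {d : ℝ} (hd : 0 < d) (hdiam : ∀ x ∈ Q, ∀ y ∈ Q, dist x y ≤ d)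
    {f : E n → ℝ≥0∞} (hf : Measurable f) {u : E n → ℝ≥0∞} (hu : AEMeasurable u (volume.restrict Q))
    (hpath : ∀ x ∈ Q, ∀ y ∈ Q,
      u x ≤ u y + ∫⁻ t in Ioc (0 : ℝ) 1, f (x + t • (y - x)) * ENNReal.ofReal (dist x y))
    {A : Set (E n)} (hA : MeasurableSet A) (hAQ : A ⊆ Q) {s : ℝ} (hs : 0 < s) (hs2 : s ≤ 1 / 2) :
    volume Q * ∫⁻ x in A, u x ^ 2 ≤
      3 * (volume A * (∫⁻ x in Q, u x ^ 2) +
        volume Q * (ENNReal.ofReal (s ^ 2 * d ^ 2) * (2 ^ n * ∫⁻ x in Q, f x ^ 2)) +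
        volume A * (farWeight n s * (ENNReal.ofReal (d ^ 2 / 2) * ∫⁻ x in Q, f x ^ 2))) := by
  -- Extension by zero lets the substitutions run over the whole space. By convexity the segments
  -- stay in `Q`, so nothing is lost.
  set φ : E n → ℝ≥0∞ := Q.indicator fun z => f z ^ 2 with hφdef
  have hφ : Measurable φ := (hf.pow_const 2).indicator hQm
  have hφi : ∫⁻ z, φ z = ∫⁻ x in Q, f x ^ 2 := lintegral_indicator hQm _
  rw [← hφi]
  set N : E n → E n → ℝ≥0∞ := fun x y =>
    ENNReal.ofReal (s * d ^ 2) * ∫⁻ t in Ioc 0 s, φ (x + t • (y - x)) with hN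
  set W : E n → E n → ℝ≥0∞ := fun x y => farWeight n s * ∫⁻ t in Ioc s 1,
    ENNReal.ofReal (t ^ (n - 1)) * φ (x + t • (y - x)) * ENNReal.ofReal (dist x y) ^ 2 with hW
  have hNm : Measurable (Function.uncurry N) := by
    have h := Measurable.lintegral_prod_right' (ν := volume.restrict (Ioc 0 s))
      (f := fun p : (E n × E n) × ℝ => φ (p.1.1 + p.2 • (p.1.2 - p.1.1))) (by fun_prop)
    exact h.const_mul (ENNReal.ofReal (s * d ^ 2))
  have hWm : Measurable (Function.uncurry W) := by
    have h := Measurable.lintegral_prod_right' (ν := volume.restrict (Ioc s 1))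
      (f := fun p : (E n × E n) × ℝ => ENNReal.ofReal (p.2 ^ (n - 1)) *
            φ (p.1.1 + p.2 • (p.1.2 - p.1.1)) * ENNReal.ofReal (dist p.1.1 p.1.2) ^ 2)
          (by fun_prop)
    exact h.const_mul (farWeight n s)
  have hpt : ∀ x ∈ Q, ∀ y ∈ Q, u x ^ 2 ≤ 3 * (u y ^ 2 + N x y + W x y) := by
    intro x hx y hy
    have hfm : Measurable fun t : ℝ => f (x + t • (y - x)) := by fun_prop
    have hz : ∀ t ∈ Ioc (0 : ℝ) 1, f (x + t • (y - x)) ^ 2 = φ (x + t • (y - x)) := by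
      intro t ht
      rw [hφdef, indicator_of_mem]
      exact hQc.add_smul_sub_mem hx hy ⟨ht.1.le, ht.2⟩
    have hsplit : ∫⁻ t in Ioc (0 : ℝ) 1, f (x + t • (y - x)) * ENNReal.ofReal (dist x y) =
        (∫⁻ t in Ioc (0 : ℝ) s, f (x + t • (y - x)) * ENNReal.ofReal (dist x y)) +
        ∫⁻ t in Ioc s 1, f (x + t • (y - x)) * ENNReal.ofReal (dist x y) := by
      rw [← Ioc_union_Ioc_eq_Ioc hs.le (by linarith : s ≤ 1),
        lintegral_union measurableSet_Ioc]
      rw [Set.disjoint_left]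
      intro t ht ht'
      exact absurd ht.2 (not_le.mpr ht'.1)
    have hnear : (∫⁻ t in Ioc (0 : ℝ) s, f (x + t • (y - x)) * ENNReal.ofReal (dist x y)) ^ 2 ≤
        N x y := by
      have hcs := sq_lintegral_mul_le (volume.restrict (Ioc 0 s)) hfm.aemeasurable
        (aemeasurable_const (b := ENNReal.ofReal (dist x y)))
      apply hcs.trans
      rw [setLIntegral_congr_fun measurableSet_Ioc
        (fun t ht => hz t ⟨ht.1, ht.2.trans (by linarith)⟩), mul_comm]
      simp only [hN]
      gcongr
      simp only [lintegral_const, Measure.restrict_apply MeasurableSet.univ, univ_inter,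
          Real.volume_Ioc, sub_zero]
      rw [← ENNReal.ofReal_pow dist_nonneg, ← ENNReal.ofReal_mul (by positivity), mul_comm]
      apply ENNReal.ofReal_le_ofReal
      gcongr
      exact hdiam x hx y hy
    have hfar : (∫⁻ t in Ioc s 1, f (x + t • (y - x)) * ENNReal.ofReal (dist x y)) ^ 2 ≤
        W x y := by
      -- Insert `t^(-(n-1)/2) t^((n-1)/2)` before Cauchy–Schwarz: the first factor yields
      -- `farWeight`, the second the weight required by `lintegral_far_le`.
      have e1 : ∀ t ∈ Ioc s 1, f (x + t • (y - x)) * ENNReal.ofReal (dist x y) =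
          ENNReal.ofReal (Real.sqrt ((t ^ (n - 1))⁻¹)) * (ENNReal.ofReal (Real.sqrt (t ^ (n - 1))) *
            f (x + t • (y - x)) * ENNReal.ofReal (dist x y)) := by
        intro t ht
        have ht0 : 0 < t := hs.trans ht.1
        rw [← mul_assoc, ← mul_assoc, ← ENNReal.ofReal_mul (by positivity),
          ← Real.sqrt_mul (by positivity), inv_mul_cancel₀ (by positivity)]
        simp
      rw [setLIntegral_congr_fun measurableSet_Ioc e1]
      have hcs := sq_lintegral_mul_le (volume.restrict (Ioc s 1))
        (f := fun t : ℝ => ENNReal.ofReal (Real.sqrt ((t ^ (n - 1))⁻¹)))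
        (g := fun t : ℝ => ENNReal.ofReal (Real.sqrt (t ^ (n - 1))) *
            f (x + t • (y - x)) * ENNReal.ofReal (dist x y)) (by fun_prop) (by fun_prop)
      apply hcs.trans
      simp only [hW, farWeight]
      apply mul_le_mul'
      all_goals
        apply setLIntegral_mono' measurableSet_Ioc
        intro t ht
      · have ht0 : 0 < t := hs.trans ht.1
        rw [← ENNReal.ofReal_pow (by positivity), Real.sq_sqrt (by positivity)]
      · have ht0 : 0 < t := hs.trans ht.1
        rw [mul_pow, mul_pow, ← ENNReal.ofReal_pow (Real.sqrt_nonneg _), Real.sq_sqrt (by positivity),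
          hz t ⟨ht0, ht.2⟩]
    calc u x ^ 2 ≤ (u y + (∫⁻ t in Ioc (0 : ℝ) s, f (x + t • (y - x)) * ENNReal.ofReal (dist x y))
          + ∫⁻ t in Ioc s 1, f (x + t • (y - x)) * ENNReal.ofReal (dist x y)) ^ 2 := by
          have h := hpath x hx y hy
          rw [hsplit, ← add_assoc] at h
          exact pow_le_pow_left' h 2
      _ ≤ _ := by
          apply (add_add_sq_le _ _ _).trans
          gcongr
  have hNint : ∫⁻ x in A, ∫⁻ y in Q, N x y ≤
      volume Q * (ENNReal.ofReal (s ^ 2 * d ^ 2) * (2 ^ n * ∫⁻ z, φ z)) := by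
    simp only [hN]
    simp_rw [lintegral_const_mul' _ _ ENNReal.ofReal_ne_top]
    have h := lintegral_near_le hφ A hs hs2 (Q := Q)
    have h2 := mul_le_mul_right h (ENNReal.ofReal (s * d ^ 2))
    apply h2.trans
    apply le_of_eq
    rw [← mul_assoc, ← ENNReal.ofReal_mul (by positivity),
      show s * d ^ 2 * s = s ^ 2 * d ^ 2 by ring]
    ring
  have hWint : ∫⁻ x in A, ∫⁻ y in Q, W x y ≤
      volume A * (farWeight n s * (ENNReal.ofReal (d ^ 2 / 2) * ∫⁻ z, φ z)) := by
    have : ∀ x ∈ A, ∫⁻ y in Q, W x y ≤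
        farWeight n s * (ENNReal.ofReal (d ^ 2 / 2) * ∫⁻ z, φ z) := by
      intro x hx
      simp only [hW]
      rw [lintegral_const_mul]
      · gcongr
        exact lintegral_far_le hd hdiam hQm hφ hs hn (hAQ hx)
      · exact Measurable.lintegral_prod_right'
          (f := fun p : E n × ℝ => ENNReal.ofReal (p.2 ^ (n - 1)) *
            φ (x + p.2 • (p.1 - x)) * ENNReal.ofReal (dist x p.1) ^ 2) (by fun_prop)
    apply (setLIntegral_mono' hA this).trans
    rw [setLIntegral_const, mul_comm]
  clear_value N W
  have hNy : ∀ x, Measurable fun y => N x y := fun x => hNm.comp measurable_prodMk_left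
  have hWy : ∀ x, Measurable fun y => W x y := fun x => hWm.comp measurable_prodMk_left
  have hNx : Measurable fun x => ∫⁻ y in Q, N x y := hNm.lintegral_prod_right
  have hWx : Measurable fun x => ∫⁻ y in Q, W x y := hWm.lintegral_prod_right
  calc volume Q * ∫⁻ x in A, u x ^ 2 = ∫⁻ x in A, volume Q * u x ^ 2 :=
        (lintegral_const_mul'' _ ((hu.mono_set hAQ).pow_const 2)).symm
    _ = ∫⁻ x in A, ∫⁻ _ in Q, u x ^ 2 := by
        simp_rw [setLIntegral_const, mul_comm]
    _ ≤ ∫⁻ x in A, ∫⁻ y in Q, 3 * (u y ^ 2 + N x y + W x y) :=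
        setLIntegral_mono' hA fun x hx => setLIntegral_mono' hQm fun y hy => hpt x (hAQ hx) y hy
    _ = ∫⁻ x in A, 3 * ((∫⁻ y in Q, u y ^ 2) + (∫⁻ y in Q, N x y) + ∫⁻ y in Q, W x y) := by
        congr 1
        ext x
        rw [lintegral_const_mul' _ _ (by norm_num), lintegral_add_right _ (hWy x),
          lintegral_add_right _ (hNy x)]
    _ = 3 * (volume A * (∫⁻ y in Q, u y ^ 2) + (∫⁻ x in A, ∫⁻ y in Q, N x y) +
          ∫⁻ x in A, ∫⁻ y in Q, W x y) := by
        rw [lintegral_const_mul' _ _ (by norm_num), lintegral_add_right _ hWx,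
          lintegral_add_right _ hNx, setLIntegral_const, mul_comm (volume A)]
    _ ≤ _ := by gcongr

/-! ### Size of the far weight in dimensions two and three -/

theorem farWeight_two {s : ℝ} (hs : 0 < s) (hs1 : s ≤ 1) :
    farWeight 2 s = ENNReal.ofReal (-Real.log s) := by
  have hint : IntervalIntegrable (fun t : ℝ => t⁻¹) volume s 1 := by
    refine intervalIntegrable_inv_iff.2 (Or.inr ?_)
    rw [uIcc_of_le hs1]
    exact fun h => absurd h.1 (not_le.mpr hs)
  simp only [farWeight, Nat.add_one_sub_one, pow_one]
  rw [← ofReal_integral_eq_lintegral_ofReal]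
  · rw [← intervalIntegral.integral_of_le hs1, integral_inv_of_pos hs one_pos]
    simp
  · exact (intervalIntegrable_iff_integrableOn_Ioc_of_le hs1).1 hint
  · filter_upwards [self_mem_ae_restrict measurableSet_Ioc] with t ht
    exact inv_nonneg.2 (hs.trans ht.1).le

theorem farWeight_three_le {s : ℝ} (hs : 0 < s) :
    farWeight 3 s ≤ ENNReal.ofReal s⁻¹ := by
  simp only [farWeight]
  calc _ ≤ ∫⁻ t in Ioi s, ENNReal.ofReal (t ^ (-2 : ℝ)) := by
        refine (setLIntegral_mono' measurableSet_Ioc fun t ht => ?_).trans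
          (lintegral_mono_set Ioc_subset_Ioi_self)
        have ht0 : 0 < t := hs.trans ht.1
        rw [Real.rpow_neg ht0.le, Real.rpow_two]
    _ = _ := by
        rw [← ofReal_integral_eq_lintegral_ofReal
          (integrableOn_Ioi_rpow_of_lt (by norm_num) hs), integral_Ioi_rpow_of_lt (by norm_num) hs]
        · congr 1
          norm_num [Real.rpow_neg_one]
        · filter_upwards [self_mem_ae_restrict measurableSet_Ioi] with t ht
          exact Real.rpow_nonneg (hs.le.trans (le_of_lt ht)) _

/-! ### Mollification -/

/-- The standard mollifier of radius about `1 / m`. -/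
def mollifier (n m : ℕ) : ContDiffBump (0 : E n) where
  rIn := 1 / (2 * ((m : ℝ) + 1))
  rOut := 1 / ((m : ℝ) + 1)
  rIn_pos := by positivity
  rIn_lt_rOut := by
    apply one_div_lt_one_div_of_lt <;> linarith [(Nat.cast_nonneg m : (0 : ℝ) ≤ m)]

/-- The convolution of `f` with the mollifier. -/
def mollify {n : ℕ} (m : ℕ) (f : E n → ℝ) : E n → ℝ :=
  convolution ((mollifier n m).normed volume) f (ContinuousLinearMap.lsmul ℝ ℝ) volume

theorem mollify_apply {n : ℕ} (m : ℕ) (f : E n → ℝ) (x : E n) :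
    mollify m f x = ∫ t, (mollifier n m).normed volume t * f (x - t) := by
  simp [mollify, convolution_def]

theorem tendsto_mollifier_rOut (n : ℕ) :
    Tendsto (fun m => (mollifier n m).rOut) atTop (𝓝 0) :=
  tendsto_one_div_add_atTop_nhds_zero_nat

theorem ae_tendsto_mollify {n : ℕ} {f : E n → ℝ} (hf : LocallyIntegrable f) :
    ∀ᵐ x, Tendsto (fun m => mollify m f x) atTop (𝓝 (f x)) := by
  -- The two radii have ratio exactly 2 for every `m`; a bounded ratio is what almost everywhere
  -- convergence requires.
  refine ContDiffBump.ae_convolution_tendsto_right_of_locallyIntegrable (K := 2)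
    (tendsto_mollifier_rOut n) (Eventually.of_forall fun m => le_of_eq ?_) hf
  simp only [mollifier]
  field_simp

theorem contDiff_mollify {n : ℕ} (m : ℕ) {f : E n → ℝ} (hf : LocallyIntegrable f) :
    ContDiff ℝ 1 (mollify m f) :=
  (mollifier n m).hasCompactSupport_normed.contDiff_convolution_left _
    (mollifier n m).contDiff_normed hf

theorem lintegral_mollifier (n m : ℕ) :
    ∫⁻ t, ENNReal.ofReal ((mollifier n m).normed volume t) = 1 := by
  rw [← ofReal_integral_eq_lintegral_ofReal (mollifier n m).integrable_normed
    (Eventually.of_forall fun t => (mollifier n m).nonneg_normed t),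
    (mollifier n m).integral_normed, ENNReal.ofReal_one]

theorem measurable_mollifier (n m : ℕ) : Measurable ((mollifier n m).normed volume) :=
  ((mollifier n m).contDiff_normed (n := 0)).continuous.measurable

/-- Jensen's inequality for the probability density of the mollifier, obtained from Cauchy–Schwarz
after splitting the density into two square roots. -/
theorem enorm_mollify_sq_le {n : ℕ} (m : ℕ) {f : E n → ℝ} (hf : AEStronglyMeasurable f)
    (x : E n) : ‖mollify m f x‖ₑ ^ 2 ≤
      ∫⁻ t, ENNReal.ofReal ((mollifier n m).normed volume t) * ‖f (x - t)‖ₑ ^ 2 := by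
  set ρ := (mollifier n m).normed volume with hρ
  have hρ0 : ∀ t, 0 ≤ ρ t := fun t => (mollifier n m).nonneg_normed t
  have hρm : Measurable ρ := measurable_mollifier n m
  have hfm : AEMeasurable fun t => ‖f (x - t)‖ₑ :=
    (hf.comp_quasiMeasurePreserving
      (quasiMeasurePreserving_sub_left volume x)).enorm
  have h1 : ‖mollify m f x‖ₑ ≤ ∫⁻ t, ENNReal.ofReal (Real.sqrt (ρ t)) *
      (ENNReal.ofReal (Real.sqrt (ρ t)) * ‖f (x - t)‖ₑ) := by
    rw [mollify_apply]
    refine (enorm_integral_le_lintegral_enorm _).trans (le_of_eq ?_)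
    congr 1
    ext t
    rw [enorm_mul, Real.enorm_of_nonneg (hρ0 t), ← mul_assoc,
      ← ENNReal.ofReal_mul (Real.sqrt_nonneg _), Real.mul_self_sqrt (hρ0 t)]
  refine (pow_le_pow_left' h1 2).trans ((sq_lintegral_mul_le _ (by fun_prop) (by fun_prop)).trans ?_)
  have e : ∀ t, ENNReal.ofReal (Real.sqrt (ρ t)) ^ 2 = ENNReal.ofReal (ρ t) := fun t => by
    rw [← ENNReal.ofReal_pow (Real.sqrt_nonneg _), Real.sq_sqrt (hρ0 t)]
  simp_rw [mul_pow, e]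
  rw [lintegral_mollifier, one_mul]

theorem lintegral_enorm_mollify_sq_le {n : ℕ} (m : ℕ) {f : E n → ℝ}
    (hf : AEStronglyMeasurable f) :
    ∫⁻ x, ‖mollify m f x‖ₑ ^ 2 ≤ ∫⁻ x, ‖f x‖ₑ ^ 2 := by
  have hρm := measurable_mollifier n m
  -- Tonelli needs joint measurability, so `f` is replaced by a measurable representative; the
  -- convolution is unchanged at every point.
  obtain ⟨f', hf', hff'⟩ := hf
  have hcongr : mollify m f = mollify m f' := by
    ext x
    rw [mollify_apply, mollify_apply]
    refine integral_congr_ae ?_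
    filter_upwards [(quasiMeasurePreserving_sub_left volume x).ae hff'] with t ht
    rw [ht]
  have hf'm : Measurable f' := hf'.measurable
  calc _ ≤ ∫⁻ x, ∫⁻ t, ENNReal.ofReal ((mollifier n m).normed volume t) * ‖f' (x - t)‖ₑ ^ 2 := by
        rw [hcongr]
        exact lintegral_mono fun x => enorm_mollify_sq_le m hf'.aestronglyMeasurable x
    _ = ∫⁻ t, ∫⁻ x, ENNReal.ofReal ((mollifier n m).normed volume t) * ‖f' (x - t)‖ₑ ^ 2 := by
        rw [lintegral_lintegral_swap]
        apply Measurable.aemeasurable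
        fun_prop
    _ = ∫⁻ t, ENNReal.ofReal ((mollifier n m).normed volume t) * ∫⁻ x, ‖f' x‖ₑ ^ 2 := by
        congr 1
        ext t
        rw [lintegral_const_mul _ (by fun_prop),
          lintegral_sub_right_eq_self (fun x => ‖f' x‖ₑ ^ 2) t]
    _ = ∫⁻ x, ‖f' x‖ₑ ^ 2 := by
        rw [lintegral_mul_const _ (by fun_prop), lintegral_mollifier, one_mul]
    _ = _ := by
        refine lintegral_congr_ae ?_
        filter_upwards [hff'] with x hx
        rw [hx]

/-- The function `y ↦ ρ(x - y)` is an admissible test function in the weak formulation exactly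
because its support lies in a ball contained in `K`. Extending `v` by zero therefore creates no
boundary term at such `x`. -/
theorem fderiv_mollify_apply {n : ℕ} (m : ℕ) {K : Set (E n)} (hK : MeasurableSet K)
    {v : E n → ℝ} {g : E n → E n} (hvg : IsH1WithGradient K v g)
    (hv : LocallyIntegrable (K.indicator v)) {x : E n}
    (hx : Metric.closedBall x (mollifier n m).rOut ⊆ K) (i : Fin n) :
    fderiv ℝ (mollify m (K.indicator v)) x (EuclideanSpace.single i 1) =
      ∫ t, (mollifier n m).normed volume t * K.indicator g (x - t) i := by
  set ρ := (mollifier n m).normed volume with hρ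
  have hρs : ContDiff ℝ ∞ ρ := (mollifier n m).contDiff_normed
  have hρd : Differentiable ℝ ρ := hρs.differentiable (by simp)
  have hρc : HasCompactSupport ρ := (mollifier n m).hasCompactSupport_normed
  have h1 := hρc.hasFDerivAt_convolution_left (ContinuousLinearMap.lsmul ℝ ℝ)
    (hρs.of_le (by norm_cast)) hv x
  have h2 : fderiv ℝ (mollify m (K.indicator v)) x (EuclideanSpace.single i 1) =
      ∫ t, fderiv ℝ ρ t (EuclideanSpace.single i 1) * K.indicator v (x - t) := by
    have h3 : fderiv ℝ (mollify m (K.indicator v)) x = _ := h1.fderiv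
    rw [h3, convolution_def]
    rw [ContinuousLinearMap.integral_apply]
    · rfl
    · exact (hρc.fderiv ℝ).convolutionExists_left _ (hρs.continuous_fderiv (by simp)) hv x
  rw [h2]
  set ψ : E n → ℝ := fun y => ρ (x - y) with hψ
  have hψs : ContDiff ℝ ∞ ψ := hρs.comp (contDiff_const.sub contDiff_id)
  have hsupp : tsupport ψ ⊆ Metric.closedBall x (mollifier n m).rOut := by
    refine closure_minimal ?_ Metric.isClosed_closedBall
    intro y hy
    have : x - y ∈ Function.support ρ := hy
    rw [hρ, ContDiffBump.support_normed_eq, mem_ball_zero_iff] at this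
    rw [Metric.mem_closedBall, dist_eq_norm, norm_sub_rev]
    exact this.le
  have hψc : HasCompactSupport ψ :=
    HasCompactSupport.of_support_subset_isCompact (isCompact_closedBall x (mollifier n m).rOut)
      ((subset_tsupport _).trans hsupp)
  have hψd : ∀ y, fderiv ℝ ψ y = - fderiv ℝ ρ (x - y) := by
    intro y
    have : HasFDerivAt ψ ((fderiv ℝ ρ (x - y)).comp (-ContinuousLinearMap.id ℝ (E n))) y := by
      refine (hρd (x - y)).hasFDerivAt.comp y ?_
      exact (hasFDerivAt_id y).const_sub x
    rw [this.fderiv]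
    ext z
    simp
  have hw := hvg.integral_eq ψ hψs hψc (hsupp.trans hx) i
  have e1 : ∫ t, fderiv ℝ ρ t (EuclideanSpace.single i 1) * K.indicator v (x - t) =
      - ∫ y in K, v y * fderiv ℝ ψ y (EuclideanSpace.single i 1) := by
    rw [← integral_sub_left_eq_self _ volume x, ← integral_indicator hK, ← integral_neg]
    congr 1
    ext y
    by_cases hy : y ∈ K
    · simp [hψd, hy, mul_comm]
    · simp [hy]
  have e2 : ∫ t, ρ t * K.indicator g (x - t) i = ∫ y in K, g y i * ψ y := by
    rw [← integral_sub_left_eq_self _ volume x, ← integral_indicator hK]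
    congr 1
    ext y
    by_cases hy : y ∈ K
    · simp [hψ, hy, mul_comm]
    · simp [hy]
  rw [e1, e2, hw, neg_neg]

theorem norm_fderiv_mollify_le {n : ℕ} (m : ℕ) {K : Set (E n)} (hK : MeasurableSet K)
    {v : E n → ℝ} {g : E n → E n} (hvg : IsH1WithGradient K v g)
    (hv : LocallyIntegrable (K.indicator v)) (hg : LocallyIntegrable (K.indicator g)) {x : E n}
    (hx : Metric.closedBall x (mollifier n m).rOut ⊆ K) :
    ‖fderiv ℝ (mollify m (K.indicator v)) x‖ ≤
      mollify m (fun y => ‖K.indicator g y‖) x := by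
  set ρ := (mollifier n m).normed volume with hρ
  have hρ0 : ∀ t, 0 ≤ ρ t := fun t => (mollifier n m).nonneg_normed t
  have hint : Integrable fun t => ρ t • K.indicator g (x - t) :=
    (mollifier n m).hasCompactSupport_normed.convolutionExists_left
      (ContinuousLinearMap.lsmul ℝ ℝ) ((mollifier n m).contDiff_normed (n := 0)).continuous hg x
  have hcoord : ∀ i, fderiv ℝ (mollify m (K.indicator v)) x (EuclideanSpace.single i 1) =
      (∫ t, ρ t • K.indicator g (x - t)) i := by
    intro i
    rw [fderiv_mollify_apply m hK hvg hv hx i]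
    have := (EuclideanSpace.proj (𝕜 := ℝ) i).integral_comp_comm hint
    simpa using this
  have hop : ‖fderiv ℝ (mollify m (K.indicator v)) x‖ ≤ ‖∫ t, ρ t • K.indicator g (x - t)‖ := by
    refine ContinuousLinearMap.opNorm_le_bound _ (norm_nonneg _) fun a => ?_
    have ha : fderiv ℝ (mollify m (K.indicator v)) x a =
        inner ℝ (∫ t, ρ t • K.indicator g (x - t)) a := by
      conv_lhs => rw [← (EuclideanSpace.basisFun (Fin n) ℝ).sum_repr a, map_sum]
      simp only [map_smul, EuclideanSpace.basisFun_apply, hcoord, EuclideanSpace.basisFun_repr]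
      simp [PiLp.inner_apply]
    rw [ha]
    exact norm_inner_le_norm _ _
  refine hop.trans ((norm_integral_le_integral_norm _).trans (le_of_eq ?_))
  rw [mollify_apply]
  congr 1
  ext t
  rw [norm_smul, Real.norm_of_nonneg (hρ0 t)]

/-! ### Bi-Lipschitz maps of class `C¹` -/

/-- `F` is of class `C¹` on the open set `U`, and it is bi-Lipschitz there with constants at most
`Λ`. -/
structure IsC1BiLipschitzOn {n : ℕ} (Λ : ℝ) (F : E n → E n) (U : Set (E n)) : Prop where
  pos : 0 < Λ
  isOpen : IsOpen U
  contDiffOn : ContDiffOn ℝ 1 F U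
  lipschitz : ∀ x ∈ U, ∀ y ∈ U, dist (F x) (F y) ≤ Λ * dist x y
  lipschitz_inv : ∀ x ∈ U, ∀ y ∈ U, dist x y ≤ Λ * dist (F x) (F y)

/-- `L` maps the unit ball into the ball of radius `Λ`; compare volumes. -/
theorem abs_det_le {n : ℕ} {Λ : ℝ} (hΛ : 0 ≤ Λ) {L : E n →L[ℝ] E n}
    (h : ∀ v, ‖L v‖ ≤ Λ * ‖v‖) : |L.det| ≤ Λ ^ n := by
  have h1 : L '' Metric.closedBall 0 1 ⊆ Metric.closedBall 0 Λ := by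
    rintro _ ⟨v, hv, rfl⟩
    rw [mem_closedBall_zero_iff] at hv ⊢
    exact (h v).trans (by nlinarith)
  have h2 := measure_mono (μ := volume) h1
  have hpos : 0 < volume (Metric.closedBall (0 : E n) 1) :=
    Metric.measure_closedBall_pos _ _ one_pos
  have hfin : volume (Metric.closedBall (0 : E n) 1) ≠ ⊤ := measure_closedBall_lt_top.ne
  rw [Measure.addHaar_image_continuousLinearMap, Measure.addHaar_closedBall' _ _ hΛ,
    finrank_euclideanSpace_fin, ENNReal.mul_le_mul_iff_left hpos.ne' hfin] at h2
  exact (ENNReal.ofReal_le_ofReal_iff (by positivity)).1 h2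

theorem one_le_mul_abs_det {n : ℕ} {Λ : ℝ} (hΛ : 0 ≤ Λ) {L : E n →L[ℝ] E n}
    (h : ∀ v, ‖v‖ ≤ Λ * ‖L v‖) : 1 ≤ Λ ^ n * |L.det| := by
  have hinj : Function.Injective L := by
    rw [injective_iff_map_eq_zero]
    intro v hv
    have := h v
    rw [hv, norm_zero, mul_zero] at this
    exact norm_le_zero_iff.1 this
  have hsurj : Function.Surjective L := (LinearMap.injective_iff_surjective (f := L.toLinearMap)).1 hinj
  have h1 : Metric.closedBall 0 1 ⊆ L '' Metric.closedBall 0 Λ := by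
    intro w hw
    obtain ⟨v, rfl⟩ := hsurj w
    refine ⟨v, ?_, rfl⟩
    rw [mem_closedBall_zero_iff] at hw ⊢
    exact (h v).trans (by nlinarith)
  have h2 := measure_mono (μ := volume) h1
  have hpos : 0 < volume (Metric.closedBall (0 : E n) 1) :=
    Metric.measure_closedBall_pos _ _ one_pos
  have hfin : volume (Metric.closedBall (0 : E n) 1) ≠ ⊤ := measure_closedBall_lt_top.ne
  rw [Measure.addHaar_image_continuousLinearMap, Measure.addHaar_closedBall' _ _ hΛ,
    finrank_euclideanSpace_fin, ← mul_assoc, ← ENNReal.ofReal_mul (by positivity)] at h2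
  nth_rw 1 [← one_mul (volume (Metric.closedBall (0 : E n) 1))] at h2
  rw [ENNReal.mul_le_mul_iff_left hpos.ne' hfin, ENNReal.one_le_ofReal] at h2
  rw [mul_comm]
  exact h2

namespace IsC1BiLipschitzOn

variable {n : ℕ} {Λ : ℝ} {F : E n → E n} {U : Set (E n)}

theorem mono (hF : IsC1BiLipschitzOn Λ F U) {V : Set (E n)} (hV : IsOpen V) (hVU : V ⊆ U) :
    IsC1BiLipschitzOn Λ F V where
  pos := hF.pos
  isOpen := hV
  contDiffOn := hF.contDiffOn.mono hVU
  lipschitz x hx y hy := hF.lipschitz x (hVU hx) y (hVU hy)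
  lipschitz_inv x hx y hy := hF.lipschitz_inv x (hVU hx) y (hVU hy)

theorem injOn (hF : IsC1BiLipschitzOn Λ F U) : InjOn F U := by
  intro x hx y hy hxy
  have := hF.lipschitz_inv x hx y hy
  rw [hxy, dist_self, mul_zero] at this
  exact dist_le_zero.1 this

theorem continuousOn (hF : IsC1BiLipschitzOn Λ F U) : ContinuousOn F U := hF.contDiffOn.continuousOn

theorem hasFDerivAt (hF : IsC1BiLipschitzOn Λ F U) {x : E n} (hx : x ∈ U) :
    HasFDerivAt F (fderiv ℝ F x) x :=
  ((hF.contDiffOn.differentiableOn (by simp)).differentiableAt (hF.isOpen.mem_nhds hx)).hasFDerivAt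

theorem norm_fderiv_le (hF : IsC1BiLipschitzOn Λ F U) {x : E n} (hx : x ∈ U) :
    ‖fderiv ℝ F x‖ ≤ Λ := by
  refine (hF.hasFDerivAt hx).le_of_lip' hF.pos.le ?_
  filter_upwards [hF.isOpen.mem_nhds hx] with y hy
  simpa [dist_eq_norm] using hF.lipschitz y hy x hx

theorem norm_le_mul_norm_fderiv (hF : IsC1BiLipschitzOn Λ F U) {x : E n} (hx : x ∈ U) (v : E n) :
    ‖v‖ ≤ Λ * ‖fderiv ℝ F x v‖ := by
  have hl := ((hF.hasFDerivAt hx).hasLineDerivAt v).tendsto_slope_zero_right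
  have hl2 := (hl.norm).const_mul Λ
  refine ge_of_tendsto hl2 ?_
  have hmem : ∀ᶠ t : ℝ in 𝓝[>] 0, x + t • v ∈ U := by
    have hc : Tendsto (fun t : ℝ => x + t • v) (𝓝[>] 0) (𝓝 (x + (0 : ℝ) • v)) :=
      (Continuous.tendsto (by fun_prop) 0).mono_left nhdsWithin_le_nhds
    rw [zero_smul, add_zero] at hc
    exact hc.eventually (hF.isOpen.mem_nhds hx)
  filter_upwards [hmem, self_mem_nhdsWithin] with t ht ht0
  have ht0 : 0 < t := ht0
  have h := hF.lipschitz_inv _ ht x hx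
  rw [dist_eq_norm, dist_eq_norm, add_sub_cancel_left, norm_smul, Real.norm_of_nonneg ht0.le] at h
  rw [norm_smul, norm_inv, Real.norm_of_nonneg ht0.le]
  rw [← mul_assoc, mul_comm Λ, mul_assoc, le_inv_mul_iff₀ ht0]
  exact h

theorem isOpen_image (hF : IsC1BiLipschitzOn Λ F U) : IsOpen (F '' U) := by
  rw [isOpen_iff_mem_nhds]
  rintro _ ⟨x, hx, rfl⟩
  have hs : HasStrictFDerivAt F (fderiv ℝ F x) x :=
    (hF.contDiffOn.contDiffAt (hF.isOpen.mem_nhds hx)).hasStrictFDerivAt (by simp)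
  have hinj : Function.Injective (fderiv ℝ F x) := by
    rw [injective_iff_map_eq_zero]
    intro v hv
    have := hF.norm_le_mul_norm_fderiv hx v
    rw [hv, norm_zero, mul_zero] at this
    exact norm_le_zero_iff.1 this
  have hsurj : Function.Surjective (fderiv ℝ F x) :=
    (LinearMap.injective_iff_surjective (f := (fderiv ℝ F x).toLinearMap)).1 hinj
  rw [← hs.map_nhds_eq_of_surj (LinearMap.range_eq_top.2 hsurj)]
  exact image_mem_map (hF.isOpen.mem_nhds hx)

theorem lintegral_image_le (hF : IsC1BiLipschitzOn Λ F U) {S : Set (E n)} (hS : MeasurableSet S)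
    (hSU : S ⊆ U) (g : E n → ℝ≥0∞) :
    ∫⁻ y in F '' S, g y ≤ ENNReal.ofReal (Λ ^ n) * ∫⁻ x in S, g (F x) := by
  rw [lintegral_image_eq_lintegral_abs_det_fderiv_mul volume hS
    (fun x hx => (hF.hasFDerivAt (hSU hx)).hasFDerivWithinAt) (hF.injOn.mono hSU),
    ← lintegral_const_mul' _ _ ENNReal.ofReal_ne_top]
  refine setLIntegral_mono' hS fun x hx => ?_
  gcongr
  exact abs_det_le hF.pos.le fun v => ContinuousLinearMap.le_of_opNorm_le _
    (hF.norm_fderiv_le (hSU hx)) v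

theorem lintegral_comp_le (hF : IsC1BiLipschitzOn Λ F U) {S : Set (E n)} (hS : MeasurableSet S)
    (hSU : S ⊆ U) (g : E n → ℝ≥0∞) :
    ∫⁻ x in S, g (F x) ≤ ENNReal.ofReal (Λ ^ n) * ∫⁻ y in F '' S, g y := by
  rw [lintegral_image_eq_lintegral_abs_det_fderiv_mul volume hS
    (fun x hx => (hF.hasFDerivAt (hSU hx)).hasFDerivWithinAt) (hF.injOn.mono hSU),
    ← lintegral_const_mul' _ _ ENNReal.ofReal_ne_top]
  refine setLIntegral_mono' hS fun x hx => ?_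
  have hΛ := hF.pos
  rw [← mul_assoc, ← ENNReal.ofReal_mul (by positivity)]
  refine le_mul_of_one_le_left zero_le ?_
  rw [ENNReal.one_le_ofReal]
  exact one_le_mul_abs_det hΛ.le (hF.norm_le_mul_norm_fderiv (hSU hx))

theorem volume_image_le (hF : IsC1BiLipschitzOn Λ F U) {S : Set (E n)} (hS : MeasurableSet S)
    (hSU : S ⊆ U) : volume (F '' S) ≤ ENNReal.ofReal (Λ ^ n) * volume S := by
  simpa using hF.lintegral_image_le hS hSU (fun _ => 1)

theorem volume_le (hF : IsC1BiLipschitzOn Λ F U) {S : Set (E n)} (hS : MeasurableSet S)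
    (hSU : S ⊆ U) : volume S ≤ ENNReal.ofReal (Λ ^ n) * volume (F '' S) := by
  simpa using hF.lintegral_comp_le hS hSU (fun _ => 1)

end IsC1BiLipschitzOn

/-! ### The estimate for functions of class `C¹` -/

theorem enorm_le_add_lintegral_fderiv {n : ℕ} {Q : Set (E n)} (hQo : IsOpen Q)
    (hQc : Convex ℝ Q) {u : E n → ℝ} (hu : ContDiffOn ℝ 1 u Q) {x y : E n} (hx : x ∈ Q)
    (hy : y ∈ Q) :
    ‖u x‖ₑ ≤ ‖u y‖ₑ +
      ∫⁻ t in Ioc (0 : ℝ) 1, ‖fderiv ℝ u (x + t • (y - x))‖ₑ * ENNReal.ofReal (dist x y) := by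
  have hmem : ∀ t ∈ Icc (0 : ℝ) 1, x + t • (y - x) ∈ Q := fun t ht =>
    hQc.add_smul_sub_mem hx hy ht
  have hcont : ContinuousOn (fun t : ℝ => fderiv ℝ u (x + t • (y - x)) (y - x)) (Icc 0 1) := by
    have h1 : ContinuousOn (fderiv ℝ u) Q := hu.continuousOn_fderiv_of_isOpen hQo (by simp)
    exact (h1.comp (Continuous.continuousOn (by fun_prop)) hmem).clm_apply continuousOn_const
  have hderiv : ∀ t ∈ uIcc (0 : ℝ) 1, HasDerivAt (fun t : ℝ => u (x + t • (y - x)))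
      (fderiv ℝ u (x + t • (y - x)) (y - x)) t := by
    intro t ht
    rw [uIcc_of_le zero_le_one] at ht
    have h1 : HasFDerivAt u _ (x + t • (y - x)) :=
      ((hu.differentiableOn (by simp)).differentiableAt (hQo.mem_nhds (hmem t ht))).hasFDerivAt
    have h2 : HasDerivAt (fun t : ℝ => x + t • (y - x)) (y - x) t := by
      simpa using ((hasDerivAt_id t).smul_const (y - x)).const_add x
    exact h1.comp_hasDerivAt t h2
  have hFTC := intervalIntegral.integral_eq_sub_of_hasDerivAt hderiv
    (ContinuousOn.intervalIntegrable (by rwa [uIcc_of_le zero_le_one]))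
  rw [intervalIntegral.integral_of_le zero_le_one] at hFTC
  simp only [one_smul, zero_smul, add_zero, add_sub_cancel] at hFTC
  have hux : u x = u y - ∫ t in Ioc (0 : ℝ) 1, fderiv ℝ u (x + t • (y - x)) (y - x) := by
    rw [hFTC]; ring
  rw [hux]
  refine (enorm_sub_le).trans ?_
  gcongr
  refine (enorm_integral_le_lintegral_enorm _).trans (lintegral_mono fun t => ?_)
  refine (ContinuousLinearMap.le_opENorm _ _).trans (le_of_eq ?_)
  rw [dist_comm, dist_eq_norm, ofReal_norm]

/-- Transport of the estimate on `Q` to the image: each change of variables costs `Λ^n`, and the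
chain rule for the squared gradient costs `Λ²`. -/
theorem IsC1BiLipschitzOn.volume_mul_lintegral_sq_le {n : ℕ} (hn : 1 ≤ n) {Λ : ℝ}
    {F : E n → E n} {Q : Set (E n)} (hF : IsC1BiLipschitzOn Λ F Q) (hQc : Convex ℝ Q) {d : ℝ}
    (hd : 0 < d) (hdiam : ∀ x ∈ Q, ∀ y ∈ Q, dist x y ≤ d) {w : E n → ℝ} (hw : ContDiff ℝ 1 w)
    {S : Set (E n)} (hS : MeasurableSet S) {s : ℝ} (hs : 0 < s) (hs2 : s ≤ 1 / 2) :
    volume Q * ∫⁻ x in S ∩ F '' Q, ‖w x‖ₑ ^ 2 ≤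
      3 * ENNReal.ofReal (Λ ^ n) * (ENNReal.ofReal (Λ ^ (2 * n)) * volume S *
          (∫⁻ x in F '' Q, ‖w x‖ₑ ^ 2) +
        (volume Q * ENNReal.ofReal (s ^ 2 * d ^ 2 * 2 ^ n * Λ ^ (n + 2)) +
          ENNReal.ofReal (d ^ 2 / 2 * Λ ^ (2 * n + 2)) * volume S * farWeight n s) *
        ∫⁻ x in F '' Q, ‖fderiv ℝ w x‖ₑ ^ 2) := by
  have hΛ := hF.pos
  have hQm := hF.isOpen.measurableSet
  set u : E n → ℝ := fun x => w (F x) with hu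
  have huC : ContDiffOn ℝ 1 u Q := hw.comp_contDiffOn hF.contDiffOn
  set A := Q ∩ F ⁻¹' S with hA
  have hAm : MeasurableSet A := by
    have h := hQm.subtype_image (hF.continuousOn.domRestrict.measurable hS)
    convert h using 1
    ext x
    simp [hA, and_comm]
  have hAQ : A ⊆ Q := inter_subset_left
  have himg : F '' A = S ∩ F '' Q := by rw [hA, image_inter_preimage, inter_comm]
  have hvolA : volume A ≤ ENNReal.ofReal (Λ ^ n) * volume S := by
    refine (hF.volume_le hAm hAQ).trans ?_
    gcongr
    rw [himg]
    exact inter_subset_left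
  have hB := TrimmedIGA.volume_mul_lintegral_sq_le hn hQm hQc hd hdiam
    (f := fun x => ‖fderiv ℝ u x‖ₑ) (measurable_fderiv ℝ u).enorm (u := fun x => ‖u x‖ₑ)
    (huC.continuousOn.aemeasurable hQm).enorm
    (fun x hx y hy => enorm_le_add_lintegral_fderiv hF.isOpen hQc huC hx hy) hAm hAQ hs hs2
  have hgrad : ∫⁻ x in Q, ‖fderiv ℝ u x‖ₑ ^ 2 ≤
      ENNReal.ofReal (Λ ^ (n + 2)) * ∫⁻ x in F '' Q, ‖fderiv ℝ w x‖ₑ ^ 2 := by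
    calc _ ≤ ∫⁻ x in Q, ENNReal.ofReal (Λ ^ 2) * ‖fderiv ℝ w (F x)‖ₑ ^ 2 := by
          refine setLIntegral_mono' hQm fun x hx => ?_
          have : fderiv ℝ u x = (fderiv ℝ w (F x)).comp (fderiv ℝ F x) :=
            (((hw.differentiable (by simp)) (F x)).hasFDerivAt.comp x (hF.hasFDerivAt hx)).fderiv
          rw [this, ENNReal.ofReal_pow hΛ.le, ← mul_pow, mul_comm]
          gcongr
          rw [← ofReal_norm, ← ofReal_norm (fderiv ℝ w (F x)), ← ENNReal.ofReal_mul (norm_nonneg _)]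
          apply ENNReal.ofReal_le_ofReal
          refine (ContinuousLinearMap.opNorm_comp_le _ _).trans ?_
          gcongr
          exact hF.norm_fderiv_le hx
      _ = ENNReal.ofReal (Λ ^ 2) * ∫⁻ x in Q, ‖fderiv ℝ w (F x)‖ₑ ^ 2 :=
          lintegral_const_mul' _ _ ENNReal.ofReal_ne_top
      _ ≤ ENNReal.ofReal (Λ ^ 2) * (ENNReal.ofReal (Λ ^ n) *
            ∫⁻ x in F '' Q, ‖fderiv ℝ w x‖ₑ ^ 2) := by
          gcongr
          exact hF.lintegral_comp_le hQm subset_rfl fun y => ‖fderiv ℝ w y‖ₑ ^ 2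
      _ = _ := by
          rw [← mul_assoc, ← ENNReal.ofReal_mul (by positivity)]
          ring_nf
  have hval : ∫⁻ x in Q, ‖u x‖ₑ ^ 2 ≤ ENNReal.ofReal (Λ ^ n) * ∫⁻ x in F '' Q, ‖w x‖ₑ ^ 2 :=
    hF.lintegral_comp_le hQm subset_rfl fun y => ‖w y‖ₑ ^ 2
  have himgle : ∫⁻ x in S ∩ F '' Q, ‖w x‖ₑ ^ 2 ≤
      ENNReal.ofReal (Λ ^ n) * ∫⁻ x in A, ‖u x‖ₑ ^ 2 := by
    rw [← himg]
    exact hF.lintegral_image_le hAm hAQ fun y => ‖w y‖ₑ ^ 2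
  generalize ∫⁻ x in F '' Q, ‖fderiv ℝ w x‖ₑ ^ 2 = G at *
  generalize ∫⁻ x in F '' Q, ‖w x‖ₑ ^ 2 = V at *
  calc _ ≤ ENNReal.ofReal (Λ ^ n) * (volume Q * ∫⁻ x in A, ‖u x‖ₑ ^ 2) := by
        rw [mul_left_comm]
        gcongr
    _ ≤ ENNReal.ofReal (Λ ^ n) * (3 * (ENNReal.ofReal (Λ ^ n) * volume S *
          (ENNReal.ofReal (Λ ^ n) * V) +
        volume Q * (ENNReal.ofReal (s ^ 2 * d ^ 2) * (2 ^ n * (ENNReal.ofReal (Λ ^ (n + 2)) * G))) +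
        ENNReal.ofReal (Λ ^ n) * volume S *
          (farWeight n s * (ENNReal.ofReal (d ^ 2 / 2) * (ENNReal.ofReal (Λ ^ (n + 2)) * G))))) := by
        refine mul_le_mul_right (hB.trans ?_) _
        gcongr
    _ = _ := by
        have e1 : ENNReal.ofReal (Λ ^ (2 * n)) = ENNReal.ofReal (Λ ^ n) * ENNReal.ofReal (Λ ^ n) := by
          rw [← ENNReal.ofReal_mul (by positivity)]; ring_nf
        have e2 : ENNReal.ofReal (s ^ 2 * d ^ 2 * 2 ^ n * Λ ^ (n + 2)) =
            ENNReal.ofReal (s ^ 2 * d ^ 2) * 2 ^ n * ENNReal.ofReal (Λ ^ (n + 2)) := by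
          rw [ENNReal.ofReal_mul (by positivity), ENNReal.ofReal_mul (by positivity),
            ENNReal.ofReal_pow (p := 2) (by norm_num)]
          norm_num
        have e3 : ENNReal.ofReal (d ^ 2 / 2 * Λ ^ (2 * n + 2)) =
            ENNReal.ofReal (d ^ 2 / 2) * (ENNReal.ofReal (Λ ^ n) * ENNReal.ofReal (Λ ^ (n + 2))) := by
          rw [← ENNReal.ofReal_mul (by positivity), ← ENNReal.ofReal_mul (by positivity)]
          ring_nf
        rw [e1, e2, e3]
        ring

/-! ### Shrinking of convex sets and passage to the limit -/

/-- The image of `Q` under the homothety of centre `c` and ratio `τ⁻¹`. -/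
def shrink {n : ℕ} (c : E n) (τ : ℝ) (Q : Set (E n)) : Set (E n) := {x | (c - τ • c) + τ • x ∈ Q}

theorem isOpen_shrink {n : ℕ} (c : E n) (τ : ℝ) {Q : Set (E n)} (hQ : IsOpen Q) :
    IsOpen (shrink c τ Q) :=
  hQ.preimage (by fun_prop)

theorem convex_shrink {n : ℕ} (c : E n) (τ : ℝ) {Q : Set (E n)} (hQ : Convex ℝ Q) :
    Convex ℝ (shrink c τ Q) := by
  intro x hx y hy a b ha hb hab
  have h := hQ hx hy ha hb hab
  have e : a • ((c - τ • c) + τ • x) + b • ((c - τ • c) + τ • y) =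
      (a + b) • (c - τ • c) + τ • (a • x + b • y) := by module
  rw [e, hab, one_smul] at h
  exact h

/-- A point of the closure is a proper convex combination of the interior point `c` and a point of
`closure Q`, hence interior to `Q`. -/
theorem closure_shrink_subset {n : ℕ} {c : E n} {τ : ℝ} (hτ : 1 < τ) {Q : Set (E n)}
    (hQ : IsOpen Q) (hQc : Convex ℝ Q) (hc : c ∈ Q) : closure (shrink c τ Q) ⊆ Q := by
  intro y hy
  have hcont : Continuous fun x : E n => (c - τ • c) + τ • x := by fun_prop
  have h1 : (c - τ • c) + τ • y ∈ closure Q :=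
    map_mem_closure (f := fun x : E n => (c - τ • c) + τ • x) hcont hy fun x hx => hx
  have hτ0 : 0 < τ := by linarith
  have h2 := hQc.combo_interior_closure_mem_interior (hQ.interior_eq.symm ▸ hc) h1
    (a := 1 - τ⁻¹) (b := τ⁻¹) (by linarith [inv_lt_one_of_one_lt₀ hτ]) (by positivity) (by ring)
  rw [hQ.interior_eq] at h2
  convert h2 using 1
  have : τ⁻¹ • (c - τ • c + τ • y) = τ⁻¹ • c - c + y := by
    rw [smul_add, smul_sub, smul_smul, smul_smul, inv_mul_cancel₀ hτ0.ne', one_smul, one_smul]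
  rw [this]
  module

theorem volume_le_shrink {n : ℕ} (c : E n) {τ : ℝ} (hτ : 0 < τ) (hτ2 : τ ≤ 2) {Q : Set (E n)}
    (hQ : IsOpen Q) : volume Q ≤ 2 ^ n * volume (shrink c τ Q) := by
  have h := lintegral_comp_add_smul (n := n) (g := Q.indicator 1)
    (measurable_one.indicator hQ.measurableSet) (c - τ • c) hτ
  have e : (fun x : E n => Q.indicator (1 : E n → ℝ≥0∞) ((c - τ • c) + τ • x)) =
      (shrink c τ Q).indicator 1 := by
    rfl
  rw [e, lintegral_indicator_one hQ.measurableSet,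
    lintegral_indicator_one (isOpen_shrink c τ hQ).measurableSet] at h
  rw [h, ← mul_assoc]
  refine le_mul_of_one_le_left zero_le ?_
  have : (2 : ℝ≥0∞) ^ n = ENNReal.ofReal (2 ^ n) := by
    rw [ENNReal.ofReal_pow (by norm_num)]; norm_num
  rw [this, ← ENNReal.ofReal_mul (by positivity), ENNReal.one_le_ofReal,
    ← div_eq_mul_inv, one_le_div (by positivity)]
  gcongr

/-- The `C¹` estimate is applied on shrunken cells with mollified functions. Replacing the volume of
a shrunken cell by that of `Q` costs the factor `2^n`. -/
theorem IsC1BiLipschitzOn.volume_mul_lintegral_sq_le_of_isH1 {n : ℕ} (hn : 1 ≤ n) {Λ : ℝ}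
    {F : E n → E n} {Q : Set (E n)} (hF : IsC1BiLipschitzOn Λ F Q) (hQc : Convex ℝ Q)
    (hQb : Bornology.IsBounded Q) (hQn : Q.Nonempty) {d : ℝ}
    (hd : 0 < d) (hdiam : ∀ x ∈ Q, ∀ y ∈ Q, dist x y ≤ d) {v : E n → ℝ} {g : E n → E n}
    (hvg : IsH1WithGradient (F '' Q) v g)
    {S : Set (E n)} (hS : MeasurableSet S) (hSK : S ⊆ F '' Q) {s : ℝ} (hs : 0 < s)
    (hs2 : s ≤ 1 / 2) :
    volume Q * ∫⁻ x in S, ‖v x‖ₑ ^ 2 ≤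
      2 ^ n * (3 * ENNReal.ofReal (Λ ^ n) * (ENNReal.ofReal (Λ ^ (2 * n)) * volume S *
          (∫⁻ x in F '' Q, ‖v x‖ₑ ^ 2) +
        (volume Q * ENNReal.ofReal (s ^ 2 * d ^ 2 * 2 ^ n * Λ ^ (n + 2)) +
          ENNReal.ofReal (d ^ 2 / 2 * Λ ^ (2 * n + 2)) * volume S * farWeight n s) *
        ∫⁻ x in F '' Q, ‖g x‖ₑ ^ 2)) := by
  obtain ⟨c, hc⟩ := hQn
  set K := F '' Q with hK
  have hKo : IsOpen K := hF.isOpen_image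
  have hKm := hKo.measurableSet
  have hQfin : volume Q ≠ ⊤ := hQb.measure_lt_top.ne
  have hKfin : volume K ≠ ⊤ :=
    ((hF.volume_image_le hF.isOpen.measurableSet subset_rfl).trans_lt
      (ENNReal.mul_lt_top ENNReal.ofReal_lt_top hQfin.lt_top)).ne
  have : IsFiniteMeasure (volume.restrict K) := ⟨by simpa using hKfin.lt_top⟩
  have hvi : Integrable (K.indicator v) :=
    (integrable_indicator_iff hKm).2 (hvg.memLp.integrable (by norm_num))
  have hgi : Integrable (K.indicator g) :=
    (integrable_indicator_iff hKm).2 (hvg.memLp_grad.integrable (by norm_num))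
  set τ : ℕ → ℝ := fun k => 1 + 1 / ((k : ℝ) + 1) with hτ
  have hτ1 : ∀ k, 1 < τ k := fun k => by
    have : 0 < 1 / ((k : ℝ) + 1) := by positivity
    simp only [hτ]; linarith
  have hτ2 : ∀ k, τ k ≤ 2 := fun k => by
    have : 1 / ((k : ℝ) + 1) ≤ 1 := by
      rw [div_le_one (by positivity)]
      linarith [(Nat.cast_nonneg k : (0 : ℝ) ≤ k)]
    simp only [hτ]; linarith
  have hτlim : Tendsto τ atTop (𝓝 1) := by
    have h := (tendsto_one_div_add_atTop_nhds_zero_nat (𝕜 := ℝ)).const_add 1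
    rwa [add_zero] at h
  set P : ℕ → Set (E n) := fun k => shrink c (τ k) Q with hP
  have hPo : ∀ k, IsOpen (P k) := fun k => isOpen_shrink c (τ k) hF.isOpen
  have hPcl : ∀ k, closure (P k) ⊆ Q := fun k => closure_shrink_subset (hτ1 k) hF.isOpen hQc hc
  have hPQ : ∀ k, P k ⊆ Q := fun k => subset_closure.trans (hPcl k)
  have hPF : ∀ k, IsC1BiLipschitzOn Λ F (P k) := fun k => hF.mono (hPo k) (hPQ k)
  have hPev : ∀ x ∈ Q, ∀ᶠ k in atTop, x ∈ P k := by
    intro x hx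
    have ht : Tendsto (fun k => (c - τ k • c) + τ k • x) atTop (𝓝 ((c - (1 : ℝ) • c) + (1 : ℝ) • x)) :=
      (tendsto_const_nhds.sub (hτlim.smul_const c)).add (hτlim.smul_const x)
    rw [one_smul, one_smul, sub_self, zero_add] at ht
    exact ht.eventually (hF.isOpen.mem_nhds hx)
  -- The closure of the shrunken cell has compact image in the open set `K`, so a small enough
  -- mollification radius keeps all balls in `K`; `m ≥ k` keeps the convergence.
  have hm : ∀ k, ∃ m ≥ k, ∀ x ∈ F '' P k, Metric.closedBall x (mollifier n m).rOut ⊆ K := by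
    intro k
    have hcomp : IsCompact (closure (P k)) := (hQb.subset (hPQ k)).isCompact_closure
    have hFcomp : IsCompact (F '' closure (P k)) :=
      hcomp.image_of_continuousOn (hF.continuousOn.mono (hPcl k))
    obtain ⟨δ, hδ, hδK⟩ := hFcomp.exists_cthickening_subset_open hKo (image_mono (hPcl k))
    obtain ⟨m, hm1, hm2⟩ := (((tendsto_mollifier_rOut n).eventually (gt_mem_nhds hδ)).and
      (eventually_ge_atTop k)).exists
    refine ⟨m, hm2, fun x hx => ?_⟩
    exact (Metric.closedBall_subset_closedBall hm1.le).trans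
      ((Metric.closedBall_subset_cthickening (image_mono subset_closure hx) δ).trans hδK)
  choose m hmk hmK using hm
  set w : ℕ → E n → ℝ := fun k => mollify (m k) (K.indicator v) with hw
  have hwC : ∀ k, ContDiff ℝ 1 (w k) := fun k => contDiff_mollify _ hvi.locallyIntegrable
  have hconv : ∀ᵐ x, Tendsto (fun k => w k x) atTop (𝓝 (K.indicator v x)) := by
    filter_upwards [ae_tendsto_mollify hvi.locallyIntegrable] with x hx
    exact hx.comp (tendsto_atTop_mono hmk tendsto_id)
  have hwV : ∀ k, ∫⁻ x in F '' P k, ‖w k x‖ₑ ^ 2 ≤ ∫⁻ x in K, ‖v x‖ₑ ^ 2 := by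
    intro k
    refine (setLIntegral_le_lintegral _ _).trans
      ((lintegral_enorm_mollify_sq_le _ hvi.aestronglyMeasurable).trans (le_of_eq ?_))
    rw [← lintegral_indicator hKm]
    congr 1
    ext x
    by_cases hx : x ∈ K <;> simp [hx]
  have hwG : ∀ k, ∫⁻ x in F '' P k, ‖fderiv ℝ (w k) x‖ₑ ^ 2 ≤ ∫⁻ x in K, ‖g x‖ₑ ^ 2 := by
    intro k
    calc _ ≤ ∫⁻ x in F '' P k, ‖mollify (m k) (fun y => ‖K.indicator g y‖) x‖ₑ ^ 2 := by
          refine setLIntegral_mono' (hPF k).isOpen_image.measurableSet fun x hx => ?_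
          gcongr
          rw [enorm_le_iff_norm_le, Real.norm_eq_abs]
          exact (norm_fderiv_mollify_le (m k) hKm hvg hvi.locallyIntegrable
            hgi.locallyIntegrable (hmK k x hx)).trans (le_abs_self _)
      _ ≤ ∫⁻ x, ‖‖K.indicator g x‖‖ₑ ^ 2 :=
          (setLIntegral_le_lintegral _ _).trans
            (lintegral_enorm_mollify_sq_le _ hgi.norm.aestronglyMeasurable)
      _ = _ := by
          rw [← lintegral_indicator hKm]
          congr 1
          ext x
          by_cases hx : x ∈ K <;> simp [hx]
  set B : ℝ≥0∞ := 2 ^ n * (3 * ENNReal.ofReal (Λ ^ n) * (ENNReal.ofReal (Λ ^ (2 * n)) * volume S *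
          (∫⁻ x in K, ‖v x‖ₑ ^ 2) +
        (volume Q * ENNReal.ofReal (s ^ 2 * d ^ 2 * 2 ^ n * Λ ^ (n + 2)) +
          ENNReal.ofReal (d ^ 2 / 2 * Λ ^ (2 * n + 2)) * volume S * farWeight n s) *
        ∫⁻ x in K, ‖g x‖ₑ ^ 2)) with hB
  have hbound : ∀ k, volume Q * ∫⁻ x in S ∩ F '' P k, ‖w k x‖ₑ ^ 2 ≤ B := by
    intro k
    have h := (hPF k).volume_mul_lintegral_sq_le hn (convex_shrink c (τ k) hQc) hd
      (fun x hx y hy => hdiam x (hPQ k hx) y (hPQ k hy)) (hwC k) hS hs hs2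
    calc _ ≤ 2 ^ n * volume (P k) * ∫⁻ x in S ∩ F '' P k, ‖w k x‖ₑ ^ 2 := by
          gcongr
          exact volume_le_shrink c (by linarith [hτ1 k]) (hτ2 k) hF.isOpen
      _ = 2 ^ n * (volume (P k) * ∫⁻ x in S ∩ F '' P k, ‖w k x‖ₑ ^ 2) := mul_assoc _ _ _
      _ ≤ _ := by
          rw [hB]
          refine mul_le_mul_right (h.trans ?_) _
          refine mul_le_mul_right (add_le_add (mul_le_mul_right (hwV k) _) ?_) _
          refine mul_le_mul' ?_ (hwG k)
          gcongr
          exact hPQ k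
  set f : ℕ → E n → ℝ≥0∞ := fun k => (S ∩ F '' P k).indicator fun x => ‖w k x‖ₑ ^ 2 with hf
  have hSk : ∀ k, MeasurableSet (S ∩ F '' P k) := fun k =>
    hS.inter (hPF k).isOpen_image.measurableSet
  have hfm : ∀ k, Measurable (f k) := fun k =>
    ((hwC k).continuous.measurable.enorm.pow_const 2).indicator (hSk k)
  -- Every point of `Q` eventually lies in the shrunken cells, so the truncated integrands converge
  -- almost everywhere on `S` and Fatou applies.
  have hlim : ∀ᵐ x, S.indicator (fun x => ‖v x‖ₑ ^ 2) x ≤ liminf (fun k => f k x) atTop := by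
    filter_upwards [hconv] with x hx
    by_cases hxS : x ∈ S
    · rw [indicator_of_mem hxS]
      obtain ⟨y, hy, rfl⟩ := hSK hxS
      have hxK : F y ∈ K := hSK hxS
      rw [indicator_of_mem hxK] at hx
      have h1 : Tendsto (fun k => f k (F y)) atTop (𝓝 (‖v (F y)‖ₑ ^ 2)) := by
        have h2 : Tendsto (fun k => ‖w k (F y)‖ₑ ^ 2) atTop (𝓝 (‖v (F y)‖ₑ ^ 2)) :=
          ENNReal.Tendsto.pow hx.enorm
        refine h2.congr' ?_
        filter_upwards [hPev y hy] with k hk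
        simp only [hf]
        rw [indicator_of_mem]
        exact ⟨hxS, mem_image_of_mem F hk⟩
      exact h1.liminf_eq.ge
    · rw [indicator_of_notMem hxS]
      exact zero_le
  calc volume Q * ∫⁻ x in S, ‖v x‖ₑ ^ 2
      ≤ volume Q * liminf (fun k => ∫⁻ x, f k x) atTop := by
        gcongr
        rw [← lintegral_indicator hS]
        exact (lintegral_mono_ae hlim).trans (lintegral_liminf_le hfm)
    _ ≤ B := by
        rw [← ENNReal.liminf_const_mul_of_ne_top hQfin]
        refine liminf_le_of_le (by isBoundedDefault) fun b hb => ?_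
        obtain ⟨k, hk⟩ := hb.exists
        refine hk.trans ?_
        simp only [hf]
        rw [lintegral_indicator (hSk k)]
        exact hbound k

/-! ### Intrinsic diameter, inscribed radius and volumes -/

theorem edist_le_pathDist {n : ℕ} (U : Set (E n)) (ξ ζ : E n) : edist ξ ζ ≤ pathDist U ξ ζ := by
  refine le_iInf₂ fun γ hγ => ?_
  have := eVariationOn.edist_le γ (s := Icc (0 : ℝ) 1) (x := 0) (y := 1) (by simp) (by simp)
  rwa [hγ.source, hγ.target] at this

theorem pathDist_image_le {n : ℕ} {Λ : ℝ} {F : E n → E n} {Q : Set (E n)}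
    (hF : IsC1BiLipschitzOn Λ F Q) (hQc : Convex ℝ Q) {x y : E n} (hx : x ∈ Q) (hy : y ∈ Q) :
    pathDist (F '' Q) (F x) (F y) ≤ ENNReal.ofReal (Λ * dist x y) := by
  set l : ℝ → E n := fun t => x + t • (y - x) with hl
  have hmem : MapsTo l (Icc 0 1) Q := fun t ht => hQc.add_smul_sub_mem hx hy ht
  have hlC : ContDiff ℝ 1 l := by fun_prop
  have hγC : ContDiffOn ℝ 1 (F ∘ l) (Icc 0 1) := hF.contDiffOn.comp hlC.contDiffOn hmem
  have hγ : IsPiecewiseC1Path (F '' Q) (F x) (F y) (F ∘ l) := by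
    refine ⟨hγC.continuousOn, fun t ht => mem_image_of_mem F (hmem ht), by simp [hl],
      by simp [hl], 1, fun i => (i : ℕ), ?_, by simp, by simp, ?_⟩
    · intro i j hij
      exact Nat.cast_le.2 (Fin.le_def.1 hij)
    · intro i
      refine hγC.mono ?_
      rw [Fin.fin_one_eq_zero i]
      simp
  refine (iInf₂_le (F ∘ l) hγ).trans ?_
  have hlip : LipschitzOnWith (Real.toNNReal (Λ * dist x y)) (F ∘ l) (Icc 0 1) := by
    refine LipschitzOnWith.of_dist_le_mul fun a ha b hb => ?_
    rw [Real.coe_toNNReal _ (mul_nonneg hF.pos.le dist_nonneg)]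
    refine (hF.lipschitz _ (hmem ha) _ (hmem hb)).trans (le_of_eq ?_)
    have : dist (l a) (l b) = dist x y * dist a b := by
      rw [dist_eq_norm, dist_eq_norm, dist_eq_norm, ← norm_neg (x - y), mul_comm, ← norm_smul]
      congr 1
      simp only [hl]
      module
    rw [this, mul_assoc]
  have h1 := hlip.comp_eVariationOn_le (g := id) (s := Icc 0 1) (mapsTo_id _)
  have h2 : eVariationOn (id : ℝ → ℝ) (Icc 0 1) ≤ 1 := by
    have := (monotoneOn_id (s := Icc (0 : ℝ) 1)).eVariationOn_eq (a := 0) (b := 1) (by simp) (by simp)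
    rw [inter_self] at this
    simp [this]
  calc _ ≤ ENNReal.ofReal (Λ * dist x y) * eVariationOn (id : ℝ → ℝ) (Icc 0 1) := h1
    _ ≤ ENNReal.ofReal (Λ * dist x y) * 1 := by gcongr
    _ = _ := mul_one _

/-- Finiteness of the supremum must be shown first, since `toReal` sends `⊤` to 0. It holds because
images of segments in the convex set `Q` are admissible paths. -/
theorem dist_le_pathDiam_image {n : ℕ} {Λ : ℝ} {F : E n → E n} {Q : Set (E n)}
    (hF : IsC1BiLipschitzOn Λ F Q) (hQc : Convex ℝ Q) (hQb : Bornology.IsBounded Q)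
    {ξ ζ : E n} (hξ : ξ ∈ F '' Q) (hζ : ζ ∈ F '' Q) : dist ξ ζ ≤ pathDiam (F '' Q) := by
  have hfin : (⨆ (ξ ∈ F '' Q) (ζ ∈ F '' Q), pathDist (F '' Q) ξ ζ) ≠ ⊤ := by
    refine ne_top_of_le_ne_top (b := ENNReal.ofReal (Λ * Metric.diam Q)) ENNReal.ofReal_ne_top ?_
    refine iSup₂_le ?_
    rintro _ ⟨x, hx, rfl⟩
    refine iSup₂_le ?_
    rintro _ ⟨y, hy, rfl⟩
    refine (pathDist_image_le hF hQc hx hy).trans (ENNReal.ofReal_le_ofReal ?_)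
    have := hF.pos
    gcongr
    exact Metric.dist_le_diam_of_mem hQb hx hy
  rw [dist_edist]
  refine ENNReal.toReal_mono hfin ((edist_le_pathDist (F '' Q) ξ ζ).trans ?_)
  exact le_iSup₂_of_le ξ hξ (le_iSup₂_of_le ζ hζ le_rfl)

/-- The volume of the unit ball. -/
def unitBallVolume (n : ℕ) : ℝ := volume.real (Metric.ball (0 : E n) 1)

theorem unitBallVolume_pos (n : ℕ) : 0 < unitBallVolume n :=
  ENNReal.toReal_pos (Metric.measure_ball_pos _ _ one_pos).ne' measure_ball_lt_top.ne

theorem volume_real_ball {n : ℕ} (x : E n) {r : ℝ} (hr : 0 < r) :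
    volume.real (Metric.ball x r) = r ^ n * unitBallVolume n := by
  rw [measureReal_def, Measure.addHaar_ball_of_pos _ _ hr, ENNReal.toReal_mul,
    ENNReal.toReal_ofReal (by positivity), finrank_euclideanSpace_fin, unitBallVolume,
    measureReal_def]

theorem volume_real_closedBall {n : ℕ} (x : E n) {r : ℝ} (hr : 0 ≤ r) :
    volume.real (Metric.closedBall x r) = r ^ n * unitBallVolume n := by
  rw [measureReal_def, Measure.addHaar_closedBall _ _ hr, ENNReal.toReal_mul,
    ENNReal.toReal_ofReal (by positivity), finrank_euclideanSpace_fin, unitBallVolume,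
    measureReal_def]

theorem inradius_nonneg {n : ℕ} (U : Set (E n)) : 0 ≤ inradius U :=
  Real.sSup_nonneg fun _ hr => hr.1.le

theorem inradius_pow_mul_le {n : ℕ} (hn : 1 ≤ n) {U : Set (E n)} (hU : volume U ≠ ⊤) :
    inradius U ^ n * unitBallVolume n ≤ volume.real U := by
  have hω := unitBallVolume_pos n
  have hn0 : (n : ℝ) ≠ 0 := by positivity
  have h : inradius U ≤ (volume.real U / unitBallVolume n) ^ (1 / (n : ℝ)) := by
    refine Real.sSup_le ?_ (by positivity)
    rintro r ⟨hr, x, hx⟩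
    have h1 := measureReal_mono hx hU
    rw [volume_real_ball x hr, ← le_div_iff₀ hω] at h1
    have h2 := Real.rpow_le_rpow (by positivity) h1 (by positivity : 0 ≤ 1 / (n : ℝ))
    rwa [← Real.rpow_natCast, ← Real.rpow_mul hr.le, mul_one_div_cancel hn0, Real.rpow_one] at h2
  have h3 := pow_le_pow_left₀ (inradius_nonneg U) h n
  rw [← Real.rpow_natCast, ← Real.rpow_natCast, ← Real.rpow_mul (by positivity), one_div_mul_cancel hn0,
    Real.rpow_one, Real.rpow_natCast, le_div_iff₀ hω] at h3
  exact h3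

/-! ### The estimate in terms of real numbers -/

theorem lintegral_enorm_sq_eq {n : ℕ} {V : Type*} [NormedAddCommGroup V] {f : E n → V}
    {S : Set (E n)} (hf : MemLp f 2 (volume.restrict S)) :
    ∫⁻ x in S, ‖f x‖ₑ ^ 2 = ENNReal.ofReal (l2Norm f S ^ 2) := by
  have hint : Integrable (fun x => ‖f x‖ ^ 2) (volume.restrict S) := hf.integrable_norm_pow (by simp)
  rw [l2Norm, Real.sq_sqrt (integral_nonneg fun x => by positivity),
    ofReal_integral_eq_lintegral_ofReal hint (Eventually.of_forall fun x => by positivity)]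
  congr 1
  ext x
  rw [ENNReal.ofReal_pow (norm_nonneg _), ofReal_norm]

theorem l2Norm_nonneg {n : ℕ} {V : Type*} [NormedAddCommGroup V] (f : E n → V) (S : Set (E n)) :
    0 ≤ l2Norm f S := Real.sqrt_nonneg _

theorem IsC1BiLipschitzOn.volume_mul_l2Norm_sq_le {n : ℕ} (hn : 1 ≤ n) {Λ : ℝ}
    {F : E n → E n} {Q : Set (E n)} (hF : IsC1BiLipschitzOn Λ F Q) (hQc : Convex ℝ Q)
    (hQb : Bornology.IsBounded Q) (hQn : Q.Nonempty) {d : ℝ}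
    (hd : 0 < d) (hdiam : ∀ x ∈ Q, ∀ y ∈ Q, dist x y ≤ d) {v : E n → ℝ} {g : E n → E n}
    (hvg : IsH1WithGradient (F '' Q) v g)
    {S : Set (E n)} (hS : MeasurableSet S) (hSK : S ⊆ F '' Q) {s : ℝ} (hs : 0 < s)
    (hs2 : s ≤ 1 / 2) {ℓ : ℝ} (hℓ : 0 ≤ ℓ) (hfar : farWeight n s ≤ ENNReal.ofReal ℓ)
    (hSfin : volume S ≠ ⊤) :
    volume.real Q * l2Norm v S ^ 2 ≤
      2 ^ n * (3 * Λ ^ n * (Λ ^ (2 * n) * volume.real S * l2Norm v (F '' Q) ^ 2 +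
        (volume.real Q * (s ^ 2 * d ^ 2 * 2 ^ n * Λ ^ (n + 2)) +
          d ^ 2 / 2 * Λ ^ (2 * n + 2) * volume.real S * ℓ) * l2Norm g (F '' Q) ^ 2)) := by
  have hΛ := hF.pos
  have hQfin : volume Q ≠ ⊤ := hQb.measure_lt_top.ne
  have h := hF.volume_mul_lintegral_sq_le_of_isH1 hn hQc hQb hQn hd hdiam hvg hS hSK hs hs2
  rw [lintegral_enorm_sq_eq (hvg.memLp.mono_measure (Measure.restrict_mono hSK le_rfl)),
    lintegral_enorm_sq_eq hvg.memLp, lintegral_enorm_sq_eq hvg.memLp_grad,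
    ← ofReal_measureReal hQfin, ← ofReal_measureReal hSfin] at h
  have hq : 0 ≤ volume.real Q := measureReal_nonneg
  have hb : 0 ≤ volume.real S := measureReal_nonneg
  generalize volume.real Q = q at *
  generalize volume.real S = b at *
  generalize l2Norm v S = N at *
  generalize l2Norm v (F '' Q) = V at *
  generalize l2Norm g (F '' Q) = G at *
  have e2 : (2 : ℝ≥0∞) ^ n = ENNReal.ofReal (2 ^ n) := by
    rw [ENNReal.ofReal_pow (by norm_num)]; norm_num
  have e3 : (3 : ℝ≥0∞) = ENNReal.ofReal 3 := by norm_num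
  have h' : ENNReal.ofReal q * ENNReal.ofReal (N ^ 2) ≤
      2 ^ n * (3 * ENNReal.ofReal (Λ ^ n) * (ENNReal.ofReal (Λ ^ (2 * n)) * ENNReal.ofReal b *
          ENNReal.ofReal (V ^ 2) +
        (ENNReal.ofReal q * ENNReal.ofReal (s ^ 2 * d ^ 2 * 2 ^ n * Λ ^ (n + 2)) +
          ENNReal.ofReal (d ^ 2 / 2 * Λ ^ (2 * n + 2)) * ENNReal.ofReal b * ENNReal.ofReal ℓ) *
        ENNReal.ofReal (G ^ 2))) := by
    refine h.trans ?_
    gcongr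
  rw [e2, e3] at h'
  rw [← ENNReal.ofReal_mul (by positivity), ← ENNReal.ofReal_mul (by positivity),
    ← ENNReal.ofReal_mul (by positivity), ← ENNReal.ofReal_mul (by positivity),
    ← ENNReal.ofReal_mul (by positivity), ← ENNReal.ofReal_mul (by positivity),
    ← ENNReal.ofReal_mul (by positivity), ← ENNReal.ofReal_add (by positivity) (by positivity),
    ← ENNReal.ofReal_mul (by positivity), ← ENNReal.ofReal_add (by positivity) (by positivity),
    ← ENNReal.ofReal_mul (by positivity), ← ENNReal.ofReal_mul (by positivity),
    ENNReal.ofReal_le_ofReal_iff (by positivity)] at h'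
  exact h'

theorem min_eta_one_le_cConst_sq {n : ℕ} (S : Set (E n)) : min eta 1 ≤ cConst S ^ 2 := by
  have h := eta_spec.1
  rw [cConst]
  split_ifs
  · rw [Real.sq_sqrt (le_max_of_le_right h.le)]
    exact (min_le_left _ _).trans (le_max_right _ _)
  · simp

theorem cConst_nonneg {n : ℕ} (S : Set (E n)) : 0 ≤ cConst S := by
  rw [cConst]
  split_ifs
  · exact Real.sqrt_nonneg _
  · exact zero_le_one

/-- The far part of the potential is controlled by `cConst`: here `h` is the size of the element,
`q` the volume of its parametric cell, and `r ^ n` the volume of its active part `S`. -/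
theorem exists_farWeight_bound {n : ℕ} (hn : n = 2 ∨ n = 3) {κ β V₀ : ℝ} (hκ : 0 < κ) (hβ : 0 < β)
    (hV : 0 ≤ V₀) :
    ∃ T, 0 < T ∧ ∀ (S : Set (E n)) (h q r : ℝ), 0 < h → 0 < r → q ≤ V₀ → κ * h ^ n ≤ q →
      r ^ n = volume.real S → r ≤ β * h →
      ∃ ℓ, 0 ≤ ℓ ∧ farWeight n (r / (2 * β * h)) ≤ ENNReal.ofReal ℓ ∧
        r ^ n * h ^ 2 * ℓ ≤ T * cConst S ^ 2 * r ^ 2 * q := by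
  have hη := eta_spec.1
  rcases hn with rfl | rfl
  · set M := 2 * β * (V₀ / κ + 1) with hM
    have hM0 : 0 < M := by positivity
    refine ⟨(M / eta + 1) / κ, by positivity, ?_⟩
    intro S h q r hh hr hqV hq hrS hrh
    have hs : 0 < r / (2 * β * h) := by positivity
    have hs1 : r / (2 * β * h) ≤ 1 := by
      rw [div_le_one (by positivity)]
      nlinarith
    have hc : cConst S ^ 2 = max (-Real.log (volume.real S)) eta := by
      rw [cConst, if_pos rfl, Real.sq_sqrt (le_max_of_le_right hη.le)]
    have hcη : eta ≤ cConst S ^ 2 := hc ▸ le_max_right _ _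
    have hcl : -(2 * Real.log r) ≤ cConst S ^ 2 := by
      have : Real.log (volume.real S) = 2 * Real.log r := by
        rw [← hrS, Real.log_pow]; norm_num
      rw [hc, this]
      exact le_max_left _ _
    generalize cConst S ^ 2 = γ at *
    have hγ : 0 < γ := hη.trans_le hcη
    have hhH : h ≤ V₀ / κ + 1 := by
      have h1 : h ^ 2 ≤ V₀ / κ := by
        rw [le_div_iff₀ hκ]; linarith
      nlinarith [sq_nonneg (h - 1)]
    have hℓ : -Real.log (r / (2 * β * h)) ≤ (M / eta + 1) * γ := by
      rw [Real.log_div hr.ne' (by positivity)]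
      have h1 : Real.log (2 * β * h) ≤ M :=
        (Real.log_le_self (by positivity)).trans (by rw [hM]; gcongr)
      have h2 : M ≤ M / eta * γ := by
        rw [div_mul_eq_mul_div, le_div_iff₀ hη]
        gcongr
      nlinarith
    refine ⟨-Real.log (r / (2 * β * h)), ?_, (farWeight_two hs hs1).le, ?_⟩
    · exact neg_nonneg.2 (Real.log_nonpos hs.le hs1)
    · calc r ^ 2 * h ^ 2 * -Real.log (r / (2 * β * h))
          ≤ r ^ 2 * (q / κ) * ((M / eta + 1) * γ) := by
            have : h ^ 2 ≤ q / κ := by rw [le_div_iff₀ hκ]; linarith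
            have h0 : 0 ≤ -Real.log (r / (2 * β * h)) := neg_nonneg.2 (Real.log_nonpos hs.le hs1)
            have hq0 : 0 ≤ q / κ := (sq_nonneg h).trans this
            gcongr
        _ = _ := by ring
  · refine ⟨2 * β / κ, by positivity, ?_⟩
    intro S h q r hh hr hqV hq hrS hrh
    have hs : 0 < r / (2 * β * h) := by positivity
    refine ⟨(r / (2 * β * h))⁻¹, by positivity, farWeight_three_le hs, ?_⟩
    have hc : cConst S ^ 2 = 1 := by
      rw [cConst, if_neg (by norm_num), one_pow]
    rw [hc]
    have : h ^ 3 ≤ q / κ := by rw [le_div_iff₀ hκ]; linarith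
    calc r ^ 3 * h ^ 2 * (r / (2 * β * h))⁻¹ = 2 * β * r ^ 2 * h ^ 3 := by field_simp
      _ ≤ 2 * β * r ^ 2 * (q / κ) := by gcongr
      _ = _ := by ring

set_option maxHeartbeats 1000000 in
theorem exists_l2Norm_le {n : ℕ} (hn : n = 2 ∨ n = 3) {Λ : ℝ} (hΛ : 0 < Λ) (σ : ℝ) {V₀ : ℝ}
    (hV : 0 ≤ V₀) :
    ∃ C, 0 < C ∧ ∀ (F : E n → E n) (Q : Set (E n)), IsC1BiLipschitzOn Λ F Q → Convex ℝ Q →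
      Bornology.IsBounded Q → Q.Nonempty → volume.real Q ≤ V₀ →
      pathDiam (F '' Q) ≤ σ * inradius (F '' Q) →
      ∀ S ⊆ F '' Q, MeasurableSet S → 0 < volume S →
      ∀ (v : E n → ℝ) (g : E n → E n), IsH1WithGradient (F '' Q) v g →
        l2Norm v S ≤ C * (cConst S * volume.real S ^ (1 / (n : ℝ))) *
          Real.sqrt ((pathDiam (F '' Q))⁻¹ ^ 2 * l2Norm v (F '' Q) ^ 2 + l2Norm g (F '' Q) ^ 2) := by
  have hn1 : 1 ≤ n := by omega
  have hn0 : (n : ℝ) ≠ 0 := by positivity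
  have hη := eta_spec.1
  set β := unitBallVolume n with hβdef
  have hβ : 0 < β := unitBallVolume_pos n
  -- This is the constant in `κ h^n ≤ |Q|`, from `h ≤ σ ρ`, the volume of the inscribed ball and
  -- `|K| ≤ Λ^n |Q|`. Using `|σ| + 1` gives positivity whatever the sign of `σ`.
  set κ := β / ((|σ| + 1) ^ n * Λ ^ n) with hκdef
  have hκ : 0 < κ := by positivity
  -- `β + 1 ≥ 1` replaces `β` so that `β ≤ (β + 1)^n`, which turns `r^n ≤ β h^n` into `r ≤ (β + 1)
  -- h` without taking roots.
  obtain ⟨T, hT, hfar⟩ := exists_farWeight_bound hn hκ (β := β + 1) (by positivity) hV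
  set γ₀ := min eta 1 with hγ₀def
  have hγ₀ : 0 < γ₀ := lt_min hη one_pos
  set C₁ := 2 ^ n * (3 * Λ ^ n * (Λ ^ (2 * n) * ((β + 1) ^ (n - 2) / κ / γ₀) +
    (2 ^ n * Λ ^ (n + 4) / γ₀ + Λ ^ (2 * n + 4) / 2 * T))) with hC₁
  have hC₁0 : 0 < C₁ := by positivity
  refine ⟨Real.sqrt C₁, Real.sqrt_pos.2 hC₁0, ?_⟩
  intro F Q hF hQc hQb hQn hQV hshape S hSK hS hSpos v g hvg
  set K := F '' Q with hK
  set h := pathDiam K with hh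
  set q := volume.real Q with hq
  set b := volume.real S with hb
  set r := b ^ (1 / (n : ℝ)) with hr
  have hQfin : volume Q ≠ ⊤ := hQb.measure_lt_top.ne
  have hKle : volume K ≤ ENNReal.ofReal (Λ ^ n) * volume Q :=
    hF.volume_image_le hF.isOpen.measurableSet subset_rfl
  have hKfin : volume K ≠ ⊤ :=
    (hKle.trans_lt (ENNReal.mul_lt_top ENNReal.ofReal_lt_top hQfin.lt_top)).ne
  have hSfin : volume S ≠ ⊤ := measure_ne_top_of_subset hSK hKfin
  have hKreal : volume.real K ≤ Λ ^ n * q := by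
    have := ENNReal.toReal_mono (ENNReal.mul_ne_top ENNReal.ofReal_ne_top hQfin) hKle
    rwa [ENNReal.toReal_mul, ENNReal.toReal_ofReal (by positivity)] at this
  have hb0 : 0 < b := ENNReal.toReal_pos hSpos.ne' hSfin
  have hr0 : 0 < r := by positivity
  have hrn : r ^ n = b := by
    rw [hr, ← Real.rpow_natCast, ← Real.rpow_mul hb0.le, one_div_mul_cancel hn0, Real.rpow_one]
  have hdist : ∀ ξ ∈ K, ∀ ζ ∈ K, dist ξ ζ ≤ h := fun ξ hξ ζ hζ =>
    dist_le_pathDiam_image hF hQc hQb hξ hζ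
  have hh0' : 0 ≤ h := ENNReal.toReal_nonneg
  have hbh : b ≤ h ^ n * β := by
    obtain ⟨x, hx⟩ := hQn
    have hsub : S ⊆ Metric.closedBall (F x) h := fun ξ hξ =>
      hdist ξ (hSK hξ) (F x) (mem_image_of_mem F hx)
    have := measureReal_mono (μ := volume) hsub measure_closedBall_lt_top.ne
    rwa [volume_real_closedBall _ hh0'] at this
  have hh0 : 0 < h := by
    rcases hh0'.eq_or_lt with h0 | h0
    · rw [← h0, zero_pow (by omega), zero_mul] at hbh
      exact absurd hbh (not_le.2 hb0)
    · exact h0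
  have hrh : r ≤ (β + 1) * h := by
    rw [← pow_le_pow_iff_left₀ hr0.le (by positivity) (by omega : n ≠ 0), hrn, mul_pow]
    refine hbh.trans ?_
    rw [mul_comm]
    gcongr
    calc β ≤ (β + 1) ^ 1 := by linarith
      _ ≤ (β + 1) ^ n := pow_le_pow_right₀ (by linarith) hn1
  have hhq : κ * h ^ n ≤ q := by
    have h1 : h ≤ (|σ| + 1) * inradius K := hshape.trans (by
      have := inradius_nonneg K
      gcongr
      linarith [le_abs_self σ])
    have h2 : h ^ n * β ≤ (|σ| + 1) ^ n * (Λ ^ n * q) := by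
      calc h ^ n * β ≤ ((|σ| + 1) * inradius K) ^ n * β := by gcongr
        _ = (|σ| + 1) ^ n * (inradius K ^ n * β) := by rw [mul_pow, mul_assoc]
        _ ≤ (|σ| + 1) ^ n * (Λ ^ n * q) :=
            mul_le_mul_of_nonneg_left ((inradius_pow_mul_le hn1 hKfin).trans hKreal)
              (by positivity)
    rw [hκdef, div_mul_eq_mul_div, div_le_iff₀ (by positivity)]
    linarith
  have hq0 : 0 < q := lt_of_lt_of_le (by positivity) hhq
  obtain ⟨ℓ, hℓ0, hℓ, hℓT⟩ := hfar S h q r hh0 hr0 hQV hhq hrn hrh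
  -- The cut is at the relative size of the active part; the denominator ensures `s ≤ 1/2`.
  set s := r / (2 * (β + 1) * h) with hs
  have hs0 : 0 < s := by positivity
  have hs2 : s ≤ 1 / 2 := by
    rw [hs, div_le_iff₀ (by positivity)]
    linarith
  have hmain := hF.volume_mul_l2Norm_sq_le hn1 hQc hQb hQn (d := Λ * h) (by positivity)
    (fun x hx y hy => (hF.lipschitz_inv x hx y hy).trans (by
      gcongr
      exact hdist _ (mem_image_of_mem F hx) _ (mem_image_of_mem F hy)))
    hvg hS hSK hs0 hs2 hℓ0 hℓ hSfin
  rw [← hK, ← hq, ← hb] at hmain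
  have hγ := min_eta_one_le_cConst_sq S
  rw [← hγ₀def] at hγ
  have hc0 := cConst_nonneg S
  generalize cConst S = c at *
  have hN0 := l2Norm_nonneg v S
  generalize l2Norm v S = N at *
  generalize l2Norm v K = V at *
  generalize l2Norm g K = G at *
  have hγ1 : 1 ≤ c ^ 2 / γ₀ := by rwa [one_le_div hγ₀]
  set X := h⁻¹ ^ 2 * V ^ 2 with hX
  have hVX : V ^ 2 = h ^ 2 * X := by
    rw [hX]; field_simp
  have hX0 : 0 ≤ X := by positivity
  -- Zero-order term: of `b = r^n` only `r²` is kept, the remaining `r^(n-2)` being traded for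
  -- `h^(n-2)`, so that `h^n` can be absorbed by `q`.
  have t1 : b * h ^ 2 ≤ q * ((β + 1) ^ (n - 2) / κ / γ₀) * c ^ 2 * r ^ 2 := by
    obtain ⟨k, rfl⟩ : ∃ k, n = k + 2 := ⟨n - 2, by omega⟩
    simp only [Nat.add_sub_cancel]
    calc b * h ^ 2 = r ^ k * r ^ 2 * h ^ 2 := by rw [← hrn, pow_add]
      _ ≤ ((β + 1) * h) ^ k * r ^ 2 * h ^ 2 := by gcongr
      _ = (β + 1) ^ k * r ^ 2 * (h ^ (k + 2)) := by rw [mul_pow, pow_add]; ring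
      _ ≤ (β + 1) ^ k * r ^ 2 * (q / κ) := by
          gcongr
          rw [le_div_iff₀ hκ]; linarith
      _ ≤ (β + 1) ^ k * r ^ 2 * (q / κ) * (c ^ 2 / γ₀) := le_mul_of_one_le_right (by positivity) hγ1
      _ = _ := by ring
  have t2 : s ^ 2 * (Λ * h) ^ 2 ≤ r ^ 2 * Λ ^ 2 * (c ^ 2 / γ₀) := by
    have e : s * (Λ * h) ≤ r * Λ := by
      rw [hs, div_mul_eq_mul_div, div_le_iff₀ (by positivity)]
      have h1 : 0 ≤ r * Λ * h * (1 + 2 * β) := by positivity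
      linarith
    calc s ^ 2 * (Λ * h) ^ 2 = (s * (Λ * h)) ^ 2 := by ring
      _ ≤ (r * Λ) ^ 2 := by gcongr
      _ = r ^ 2 * Λ ^ 2 := by ring
      _ ≤ _ := le_mul_of_one_le_right (by positivity) hγ1
  rw [hrn] at hℓT
  have hfinal : q * N ^ 2 ≤ q * (C₁ * c ^ 2 * r ^ 2 * (X + G ^ 2)) := by
    refine hmain.trans ?_
    calc _ = 2 ^ n * (3 * Λ ^ n * (Λ ^ (2 * n) * (b * h ^ 2) * X +
        (q * (s ^ 2 * (Λ * h) ^ 2 * 2 ^ n * Λ ^ (n + 2)) +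
          Λ ^ (2 * n + 4) / 2 * (b * h ^ 2 * ℓ)) * G ^ 2)) := by rw [hVX]; ring
      _ ≤ 2 ^ n * (3 * Λ ^ n * (Λ ^ (2 * n) * (q * ((β + 1) ^ (n - 2) / κ / γ₀) * c ^ 2 * r ^ 2) * X +
        (q * (r ^ 2 * Λ ^ 2 * (c ^ 2 / γ₀) * 2 ^ n * Λ ^ (n + 2)) +
          Λ ^ (2 * n + 4) / 2 * (T * c ^ 2 * r ^ 2 * q)) * G ^ 2)) := by gcongr
      _ = 2 ^ n * (3 * Λ ^ n * (Λ ^ (2 * n) * ((β + 1) ^ (n - 2) / κ / γ₀) * X +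
          (2 ^ n * Λ ^ (n + 4) / γ₀ + Λ ^ (2 * n + 4) / 2 * T) * G ^ 2)) * (q * c ^ 2 * r ^ 2) := by
          ring
      _ ≤ 2 ^ n * (3 * Λ ^ n * ((Λ ^ (2 * n) * ((β + 1) ^ (n - 2) / κ / γ₀) +
          (2 ^ n * Λ ^ (n + 4) / γ₀ + Λ ^ (2 * n + 4) / 2 * T)) * (X + G ^ 2))) *
            (q * c ^ 2 * r ^ 2) := by
          have hA : 0 ≤ Λ ^ (2 * n) * ((β + 1) ^ (n - 2) / κ / γ₀) := by positivity
          have hB : 0 ≤ 2 ^ n * Λ ^ (n + 4) / γ₀ + Λ ^ (2 * n + 4) / 2 * T := by positivity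
          gcongr
          refine (le_add_of_nonneg_right
            (add_nonneg (mul_nonneg hA (sq_nonneg G)) (mul_nonneg hB hX0))).trans (le_of_eq ?_)
          ring
      _ = _ := by rw [hC₁]; ring
  have hfin2 : N ^ 2 ≤ (Real.sqrt C₁ * (c * r) * Real.sqrt (X + G ^ 2)) ^ 2 := by
    rw [mul_pow, mul_pow, mul_pow, Real.sq_sqrt hC₁0.le, Real.sq_sqrt (by positivity), ← mul_assoc]
    exact le_of_mul_le_mul_left hfinal hq0
  exact (pow_le_pow_iff_left₀ hN0 (by positivity) two_ne_zero).1 hfin2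

/-! ### Cells of a hierarchical mesh -/

theorem isBounded_unitCube (n : ℕ) : Bornology.IsBounded (unitCube n) := by
  refine (Metric.isBounded_closedBall (x := (0 : E n)) (r := Real.sqrt n)).subset fun x hx => ?_
  rw [mem_closedBall_zero_iff, EuclideanSpace.norm_eq]
  apply Real.sqrt_le_sqrt
  calc ∑ i, ‖x i‖ ^ 2 ≤ ∑ _ : Fin n, (1 : ℝ) := by
        refine Finset.sum_le_sum fun i _ => ?_
        rw [Real.norm_eq_abs, sq_abs]
        nlinarith [(hx i).1, (hx i).2]
    _ = n := by simp

/-- The inverse Lipschitz bound at two distinct points of the cube excludes `Λ ≤ 0`. -/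
theorem pos_of_isRegularParametrization {n : ℕ} (hn : 1 ≤ n) {Λ : ℝ} {M : HierarchicalMesh n}
    {F : E n → E n} (hF : IsRegularParametrization Λ M F) : 0 < Λ := by
  set x : E n := WithLp.toLp 2 fun _ => 1 / 2 with hx
  set y : E n := WithLp.toLp 2 fun _ => 1 / 3 with hy
  have hxy : x ≠ y := by
    intro h
    have := congrArg (fun z : E n => z ⟨0, hn⟩) h
    norm_num [hx, hy] at this
  have h := hF.lipschitz_inv x (fun j => by norm_num [hx]) y (fun j => by norm_num [hy])
  exact pos_of_mul_pos_left ((dist_pos.2 hxy).trans_le h) dist_nonneg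

theorem HierarchicalMesh.subdomain_subset_unitCube {n : ℕ} (M : HierarchicalMesh n) {ℓ : ℕ}
    (hℓ : ℓ ≤ M.L) : M.subdomain ℓ ⊆ unitCube n := by
  induction ℓ with
  | zero => exact M.subdomain_zero.subset
  | succ k ih => exact (M.subdomain_anti k hℓ).trans (ih (Nat.le_of_succ_le hℓ))

theorem HierarchicalMesh.subset_unitCube_of_mem_cells {n : ℕ} {M : HierarchicalMesh n}
    {Q : Set (E n)} (hQ : Q ∈ M.cells) : Q ⊆ unitCube n := by
  obtain ⟨ℓ, hℓ, -, hQℓ, -⟩ := hQ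
  exact hQℓ.trans (M.subdomain_subset_unitCube hℓ)

theorem isOpen_convex_nonempty_of_mem_bezierMesh {n : ℕ} {Z : Fin n → Finset ℝ} {Q : Set (E n)}
    (hQ : Q ∈ bezierMesh Z) : IsOpen Q ∧ Convex ℝ Q ∧ Q.Nonempty := by
  obtain ⟨a, b, hab, rfl⟩ := hQ
  refine ⟨?_, ?_, ?_⟩
  · have : {x : E n | ∀ j, a j < x j ∧ x j < b j} = ⋂ j, {x : E n | a j < x j ∧ x j < b j} := by
      ext x; simp
    rw [this]
    refine isOpen_iInter_of_finite fun j => ?_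
    have hj : Continuous fun x : E n => x j := by fun_prop
    exact (isOpen_lt continuous_const hj).inter (isOpen_lt hj continuous_const)
  · intro x hx y hy s t hs ht hst j
    exact convex_Ioo (a j) (b j) (hx j) (hy j) hs ht hst
  · refine ⟨WithLp.toLp 2 fun j => (a j + b j) / 2, fun j => ?_⟩
    have := (hab j).2.2.1
    constructor <;> simp only <;> linarith

theorem IsRegularParametrization.isC1BiLipschitzOn {n : ℕ} (hn : 1 ≤ n) {Λ : ℝ}
    {M : HierarchicalMesh n} {F : E n → E n} (hF : IsRegularParametrization Λ M F)
    {Q : Set (E n)} (hQ : Q ∈ M.cells) : IsC1BiLipschitzOn Λ F Q := by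
  have hQU := HierarchicalMesh.subset_unitCube_of_mem_cells hQ
  obtain ⟨G, hG, hGF⟩ := hF.smooth Q hQ
  refine ⟨pos_of_isRegularParametrization hn hF, ?_, ?_, fun x hx y hy =>
    hF.lipschitz x (hQU hx) y (hQU hy), fun x hx y hy => hF.lipschitz_inv x (hQU hx) y (hQU hy)⟩
  · obtain ⟨ℓ, -, hQℓ, -⟩ := hQ
    exact (isOpen_convex_nonempty_of_mem_bezierMesh hQℓ).1
  · exact ((hG.mono subset_closure).of_le (by norm_cast)).congr fun x hx => (hGF hx).symm

end TrimmedIGA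

end

/-! ### The estimate on cut elements -/

open TrimmedIGA in
theorem lemma5p1 (n : ℕ) (hn : n = 2 ∨ n = 3) (Λ σ : ℝ) :
    ∃ C : ℝ, 0 < C ∧
      ∀ (M : HierarchicalMesh n) (F : E n → E n),
        IsRegularParametrization Λ M F →
        ShapeRegular σ (physicalMesh M F) →
        ∀ (s : ℕ) (D : Fin s → Set (E n)),
          (∀ i, IsOpen (D i) ∧ IsConnected (D i) ∧ Bornology.IsBounded (D i)) →
          ∀ K ∈ cutElements (physicalMesh M F) (trimmedDomain F D),
            ∀ (v : E n → ℝ) (g : E n → E n), IsH1WithGradient K v g →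
              l2Norm v (K ∩ trimmedDomain F D) ≤
                C * (cConst (K ∩ trimmedDomain F D) *
                    volume.real (K ∩ trimmedDomain F D) ^ (1 / (n : ℝ))) *
                  Real.sqrt ((pathDiam K)⁻¹ ^ 2 * l2Norm v K ^ 2 + l2Norm g K ^ 2) ∧
              cConst (K ∩ trimmedDomain F D) *
                  volume.real (K ∩ trimmedDomain F D) ^ (1 / (n : ℝ)) =
                delta (trimmedDomain F D) K := by
  have hn1 : 1 ≤ n := by omega
  rcases le_or_gt Λ 0 with hΛ | hΛ
  · exact ⟨1, one_pos, fun M F hF =>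
      absurd (pos_of_isRegularParametrization hn1 hF) (not_lt.2 hΛ)⟩
  -- All cells lie in the unit cube, so its volume serves as the uniform bound `V₀` and `C` does not
  -- depend on the mesh.
  obtain ⟨C, hC, hmain⟩ := exists_l2Norm_le hn hΛ σ
    (MeasureTheory.measureReal_nonneg (μ := volume) (s := unitCube n))
  refine ⟨C, hC, ?_⟩
  rintro M F hF hσ s D - K ⟨hKmesh, hcut, hpos⟩ v g hvg
  refine ⟨?_, ?_⟩
  · have hshape := hσ K hKmesh
    obtain ⟨Q, hQ, rfl⟩ := hKmesh
    have hFQ := hF.isC1BiLipschitzOn hn1 hQ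
    have hQU := HierarchicalMesh.subset_unitCube_of_mem_cells hQ
    have hQbox : IsOpen Q ∧ Convex ℝ Q ∧ Q.Nonempty := by
      obtain ⟨ℓ, -, hQℓ, -⟩ := hQ
      exact isOpen_convex_nonempty_of_mem_bezierMesh hQℓ
    have hbU := isBounded_unitCube n
    refine hmain F Q hFQ hQbox.2.1 (hbU.subset hQU) hQbox.2.2
      (MeasureTheory.measureReal_mono hQU hbU.measure_lt_top.ne) hshape _ Set.inter_subset_left
      ?_ hpos v g hvg
    have : F '' Q ∩ trimmedDomain F D =
        F '' Q \ closure (interior (⋃ i, closure (D i))) := by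
      rw [trimmedDomain, ← Set.inter_sdiff_assoc, Set.inter_eq_left.2 (Set.image_mono hQU)]
    rw [this]
    exact hFQ.isOpen_image.measurableSet.diff isClosed_closure.measurableSet
  · rw [delta, if_neg]
    exact fun h => hcut (Set.inter_eq_left.2 h)
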